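/- Let $X$ be a geodesic metric space that is $\delta$-hyperbolic for some $\delta>0$ (for every geodesic triangle, each side lies in the closed $\delta$-neighbourhood of the union of the other two). Let $G$ be a group acting on $X$ by isometries that is not virtually cyclic, and let $f\in G$ be a unital axial WPD element: there is a bi-infinite geodesic $\gamma:\mathbb{R}\to X$ with $f\gamma(t)=\gamma(t+1)$ for all $t$, and, for a point $x_0\in\gamma(\mathbb{R})$, for every $\rho>0$ there is an integer $L>0$ such that $$\#\{g\in G: d_X(x_0,gx_0)<\rho \text{ and } d_X(f^Lx_0,gf^Lx_0)<\rho\}<\infty .$$ Let $S$ be a finite generating set of $G$, with word metric $d_S(g,h)=\min\{n\ge 0: h=gs_1\cdots s_n,\ s_i\in S\cup S^{-1}\}$ and Cayley graph with edges $\{g,gs\}$, $s\in S\cup S^{-1}$. Write $(z|y)_{x_0}=\tfrac12\left[d_X(x_0,z)+d_X(x_0,y)-d_X(z,y)\right]$ and $\mathcal{H}_R(x_0,y)=\{z\in X:(z|y)_{x_0}>R\}$. Then there is $r>0$ such that for every $R>0$ and every $y\in X$ there are pairwise disjoint sets $B_1,\dots,B_{\lfloor R/r\rfloor}\subseteq G$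 with the following two properties. 1. The union $B=B_1\sqcup\dots\sqcup B_{\lfloor R/r\rfloor}$ is $r$-roughly branching: there is $B'\subseteq G$ such that every element of $B$ is at $d_S$-distance at most $r$ from an element of $B'$, and for every $k\ge1$, any two distinct $k$-tuples $(g_1,\dots,g_k)\ne(h_1,\dots,h_k)$ of elements of $B'$ satisfy $g_1\cdots g_k\neq h_1\cdots h_k$. 2. Each $B_i$ is a $d_S$-barrier between $id$ and $\{g\in G: gx_0\in\mathcal{H}_R(x_0,y)\}$: for every $g\in G$ with $gx_0\in\mathcal{H}_R(x_0,y)$, every path in the Cayley graph from $id$ to $g$ contains an element of $B_i$. -/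

import Mathlib

namespace HypBarrier

section Metric

variable {X : Type*} [MetricSpace X]

/-- The closed `R`-neighbourhood of a set: the points at distance at most `R` from some point
of the set. -/
def nbhd (R : ℝ) (A : Set X) : Set X :=
  {x | ∃ a ∈ A, dist a x ≤ R}

/-- `s` is the image of a geodesic segment from `x` to `y`. -/
def IsGeodesicSegment (x y : X) (s : Set X) : Prop :=
  ∃ c : ℝ → X, c 0 = x ∧ c (dist x y) = y ∧
    (∀ t ∈ Set.Icc 0 (dist x y), ∀ u ∈ Set.Icc 0 (dist x y), dist (c t) (c u) = |t - u|) ∧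
    s = c '' Set.Icc 0 (dist x y)

variable (X) in
/-- Any two points are joined by a geodesic segment. -/
def IsGeodesicSpace : Prop :=
  ∀ x y : X, ∃ s : Set X, IsGeodesicSegment x y s

variable (X) in
/-- `δ`-hyperbolicity in the sense of Rips, for a geodesic metric space: every geodesic
triangle is `δ`-thin. -/
def IsHyperbolic (δ : ℝ) : Prop :=
  IsGeodesicSpace X ∧
    ∀ (x y z : X) (a b c : Set X),
      IsGeodesicSegment x y a → IsGeodesicSegment y z b → IsGeodesicSegment x z c →
        c ⊆ nbhd δ a ∪ nbhd δ b

/-- The Gromov product `(y | z)_x`. -/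
noncomputable def gromovProduct (x y z : X) : ℝ :=
  (dist x y + dist x z - dist y z) / 2

/-- The halfspace `{z | (z | y)_x > R}`. -/
def halfspace (R : ℝ) (x y : X) : Set X :=
  {z | R < gromovProduct x z y}

end Metric

section Action

variable {G X : Type*} [Group G] [MetricSpace X] [MulAction G X]

/-- `γ` is an axis along which `f` translates by the length `1`; that is, `γ` witnesses that `f` is
a unital axial loxodromic. Here `Isometry γ` says that `γ` is a bi-infinite geodesic. -/
def IsUnitalAxis (f : G) (γ : ℝ → X) : Prop :=
  Isometry γ ∧ ∀ t : ℝ, f • γ t = γ (t + 1)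

/-- Weak proper discontinuity along `f`, tested at the base point `x₀`. -/
def IsWPD (f : G) (x₀ : X) : Prop :=
  ∀ R : ℝ, 0 < R → ∃ L : ℕ, 0 < L ∧
    {g : G | dist x₀ (g • x₀) < R ∧ dist (f ^ L • x₀) (g • f ^ L • x₀) < R}.Finite

end Action

section Groups

variable {G : Type*} [Group G]

variable (G) in
/-- `G` has a cyclic subgroup of finite index. In particular finite groups are virtually cyclic. -/
def IsVirtuallyCyclic : Prop :=
  ∃ H : Subgroup G, IsCyclic H ∧ H.FiniteIndex

/-- The word metric: the least length of a word `w` in `S ∪ S⁻¹` with `h = g * w`.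
(Used only when `S` generates `G`, so that the infimum is over a nonempty set.) -/
noncomputable def wordDist (S : Set G) (g h : G) : ℕ :=
  sInf {n : ℕ | ∃ l : List G, l.length = n ∧ (∀ s ∈ l, s ∈ S ∨ s⁻¹ ∈ S) ∧ h = g * l.prod}

/-- `B` is a `d_S`-barrier between `A` and `C`: each path from `A` to `C` in the Cayley graph of
`G` with respect to `S` (edges `g — g * s`) meets `B`. Repeated vertices are allowed. -/
def IsBarrier (S A B C : Set G) : Prop :=
  ∀ a ∈ A, ∀ c ∈ C, ∀ p : (SimpleGraph.mulCayley S).Walk a c, ∃ b ∈ p.support, b ∈ B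

/-- `B` is `r`-roughly branching: it lies in the `r`-neighbourhood, for the word metric, of a set
`B'` such that for each `k ≥ 1` distinct `k`-tuples of elements of `B'` have distinct products. -/
def IsRoughlyBranching (S : Set G) (r : ℝ) (B : Set G) : Prop :=
  ∃ B' : Set G,
    (∀ b ∈ B, ∃ b' ∈ B', (wordDist S b' b : ℝ) ≤ r) ∧
    ∀ k : ℕ, 1 ≤ k → ∀ g h : Fin k → G,
      (∀ i, g i ∈ B') → (∀ i, h i ∈ B') → g ≠ h →
        (List.ofFn g).prod ≠ (List.ofFn h).prod

end Groups

end HypBarrier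

/-!
The geometry enters through Gromov's four-point inequality (`IsHyperbolic.fourPoint`) and through
nearest points on geodesic lines: if two points have distant nearest points on a line, then a
geodesic between them follows the line from one to the other (`IsNearest.le_dist`), and two lines
satisfy Behrstock's inequality (`IsNearest.behrstock`). The WPD property enters three times. Two
translates of the axis `γ` either are uniformly close or have uniformly bounded projections to
each other, according to whether they belong to the same coset of the commensurator of `⟨f⟩`
(`exists_overlap_bound`, `IsNearest.dist_le_of_mem_elementaryClosure`); this commensurator is
virtually cyclic, so that a group which is not virtually cyclic provides independent translates of
the axis (`exists_independent_directions`); and the letters of the code below are determined up to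
finitely many possibilities by the start of their stem.

Reparametrise so that `x₀ = γ 0`, and let `p` be a point of a geodesic from `x₀` to `y`. The
barrier at `p` consists of those `g` for which `g • x₀` projects near `p` and a geodesic from `p`
to `g • x₀` follows no translate of `γ` for a long time (`AvoidsAxes`). Dropping the second
condition would give an obvious barrier which is far too large to be roughly branching.

*It is a barrier* (`exists_mem_support_avoidsAxes`). The oriented translates of `γ` form a
`ProjectionFamily` as seen from `p`. The parent of a point `x` is the last axis followed for a
length `K` on the way from `p` to `x`, and the parent of an axis is that of its gate. In this
forest every axis that is followed from `p` to `x` for slightly more than `K` is exactly an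
ancestor of `x` (`ProjectionFamily.isRoot_iff_isRootOfAxis`). Consecutive vertices of a path in
the Cayley graph that share a deep axis therefore have the same root, and points with the same
root lie on the same side of `p`. So a path crossing from one side to the other has a vertex near
`p` without deep axes.

*It is roughly branching* (`exists_isRoughlyBranching`), even when the union over all `p` is
taken. An element `g` of a barrier is replaced by the letter `g * u * f ^ N * v` with `N` large,
where `u` is one of four independent directions, chosen so that the axis through `g * u` leaves
the orbit point of `g` in a direction different from that of `x₀`, of `y` and of the end of the
marker line `v⁻¹ • γ`, and `v` is chosen so that `v⁻¹ • γ` leaves `x₀` in a direction different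
from that of `y`. A geodesic from `x₀` to the orbit point of a product of letters then follows the
stem of the first letter for its whole length (`IsMarker.stem_nearly_between`). If two products
agree, then both first stems lie on one geodesic. If one of them started after the middle of the
other, a geodesic to an element of a barrier would follow a translate of `γ` for a long time away
from the geodesic to `y`, which is excluded. So they start close to each other, and by WPD the
first letters differ by an element of a fixed finite set (`IsMarker.exists_eq_mul`). In a maximal
subset of the letters without such pairs, they are equal.
-/

namespace HypBarrier

/-! ### The four-point inequality -/

section FourPoint

variable {X : Type*} [MetricSpace X]

variable (X) in
/-- Gromov's four-point inequality: of the three sums of opposite sides of a quadrilateral, the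
two largest differ by at most `δ`. -/
def FourPoint (δ : ℝ) : Prop :=
  ∀ x y z w : X, dist x y + dist z w ≤ max (dist x z + dist y w) (dist x w + dist y z) + δ

theorem FourPoint.nonneg {δ : ℝ} (H : FourPoint X δ) (x : X) : 0 ≤ δ := by
  simpa using H x x x x

/-- The form in which the four-point inequality is used: one of two linear inequalities holds. -/
theorem FourPoint.le_or {δ : ℝ} (H : FourPoint X δ) (x y z w : X) :
    dist x y + dist z w ≤ dist x z + dist y w + δ ∨
      dist x y + dist z w ≤ dist x w + dist y z + δ := by
  rcases max_choice (dist x z + dist y w) (dist x w + dist y z) with h | h <;>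
    have := H x y z w <;> rw [h] at this <;> simp [this]

theorem IsGeodesicSegment.dist_add_dist {x y z : X} {s : Set X} (hs : IsGeodesicSegment x y s)
    (hz : z ∈ s) : dist x z + dist z y = dist x y := by
  obtain ⟨c, h0, h1, hc, rfl⟩ := hs
  obtain ⟨t, ht, rfl⟩ := hz
  have hl : (0 : ℝ) ∈ Set.Icc 0 (dist x y) := ⟨le_rfl, dist_nonneg⟩
  have hr : dist x y ∈ Set.Icc 0 (dist x y) := ⟨dist_nonneg, le_rfl⟩
  have e1 := hc 0 hl t ht
  have e2 := hc t ht _ hr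
  rw [h0, zero_sub, abs_neg, abs_of_nonneg ht.1] at e1
  rw [h1, abs_sub_comm, abs_of_nonneg (by linarith [ht.2])] at e2
  linarith

theorem IsGeodesicSpace.exists_between (hX : IsGeodesicSpace X) {o y : X} {t : ℝ} (h0 : 0 ≤ t)
    (ht : t ≤ dist o y) : ∃ p, dist o p = t ∧ dist o p + dist p y = dist o y := by
  obtain ⟨s, hs⟩ := hX o y
  obtain ⟨c, hc0, hc1, hc, rfl⟩ := id hs
  have hd := hc 0 ⟨le_rfl, dist_nonneg⟩ t ⟨h0, ht⟩
  rw [hc0, zero_sub, abs_neg, abs_of_nonneg h0] at hd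
  exact ⟨c t, hd, hs.dist_add_dist ⟨t, ⟨h0, ht⟩, rfl⟩⟩

theorem IsGeodesicSegment.continuousOn {x y : X} {c : ℝ → X}
    (hc : ∀ t ∈ Set.Icc 0 (dist x y), ∀ u ∈ Set.Icc 0 (dist x y), dist (c t) (c u) = |t - u|) :
    ContinuousOn c (Set.Icc 0 (dist x y)) := by
  rw [Metric.continuousOn_iff]
  intro t ht ε hε
  exact ⟨ε, hε, fun u hu h => by rwa [hc u hu t ht, ← Real.dist_eq]⟩

theorem IsGeodesicSegment.isCompact {x y : X} {s : Set X} (hs : IsGeodesicSegment x y s) :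
    IsCompact s := by
  obtain ⟨c, h0, h1, hc, rfl⟩ := hs
  exact isCompact_Icc.image_of_continuousOn (continuousOn hc)

theorem IsGeodesicSegment.isPreconnected {x y : X} {s : Set X} (hs : IsGeodesicSegment x y s) :
    IsPreconnected s := by
  obtain ⟨c, h0, h1, hc, rfl⟩ := hs
  exact isPreconnected_Icc.image c (continuousOn hc)

theorem IsGeodesicSegment.left_mem {x y : X} {s : Set X} (hs : IsGeodesicSegment x y s) :
    x ∈ s := by
  obtain ⟨c, h0, h1, hc, rfl⟩ := hs
  exact ⟨0, ⟨le_rfl, dist_nonneg⟩, h0⟩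

theorem IsGeodesicSegment.right_mem {x y : X} {s : Set X} (hs : IsGeodesicSegment x y s) :
    y ∈ s := by
  obtain ⟨c, h0, h1, hc, rfl⟩ := hs
  exact ⟨dist x y, ⟨dist_nonneg, le_rfl⟩, h1⟩

theorem isClosed_nbhd {R : ℝ} (hR : 0 ≤ R) {A : Set X} (hA : IsCompact A) :
    IsClosed (nbhd R A) := by
  have : nbhd R A = Metric.cthickening R A := by
    rw [hA.cthickening_eq_biUnion_closedBall hR]
    ext x
    simp [nbhd, dist_comm]
  rw [this]
  exact Metric.isClosed_cthickening

/-- Thin triangles imply the four-point inequality. A geodesic `[x, z]` contains, by connectedness,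
a point close to both `[x, w]` and `[w, z]`, so that the distance from `w` to `[x, z]` agrees with
the Gromov product `(x | z)_w` up to `2 * δ`; and `[x, z]` lies close to `[x, y] ∪ [y, z]`. -/
theorem IsHyperbolic.fourPoint {δ : ℝ} (hδ : 0 ≤ δ) (hX : IsHyperbolic X δ) :
    FourPoint X (6 * δ) := by
  intro x z y w
  obtain ⟨hg, ht⟩ := hX
  obtain ⟨c, hc⟩ := hg x z
  obtain ⟨a, ha⟩ := hg x w
  obtain ⟨b, hb⟩ := hg w z
  obtain ⟨a', ha'⟩ := hg x y
  obtain ⟨b', hb'⟩ := hg y z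
  have hcover := ht x w z a b c ha hb hc
  obtain ⟨m, hmc, ⟨q, hq, hqm⟩, ⟨q', hq', hqm'⟩⟩ :=
    isPreconnected_closed_iff.1 hc.isPreconnected _ _ (isClosed_nbhd hδ ha.isCompact)
      (isClosed_nbhd hδ hb.isCompact) hcover
      ⟨x, hc.left_mem, x, ha.left_mem, by simpa using hδ⟩
      ⟨z, hc.right_mem, z, hb.right_mem, by simpa using hδ⟩
  have e1 := ha.dist_add_dist hq
  have e2 := hb.dist_add_dist hq'
  have e3 := hc.dist_add_dist hmc
  have t1 : dist x m ≤ dist x q + dist q m := dist_triangle _ _ _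
  have t2 : dist m w ≤ dist q m + dist q w := by
    rw [dist_comm q m]; exact dist_triangle _ _ _
  have t3 : dist m w ≤ dist w q' + dist q' m := by
    rw [dist_comm m w]; exact dist_triangle _ _ _
  have t4 : dist m z ≤ dist q' m + dist q' z := by
    rw [dist_comm q' m]; exact dist_triangle _ _ _
  have key : ∀ u v n : X, dist u n + dist n v = dist u v → dist n m ≤ δ →
      dist u w + dist w v ≤ dist u v + 2 * (dist m w + δ) := by
    intro u v n hn hnm
    have s1 : dist u w ≤ dist u n + dist n m + dist m w := dist_triangle4 _ _ _ _
    have s2 : dist w v ≤ dist m w + dist n m + dist n v := by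
      rw [dist_comm m w, dist_comm n m]; exact dist_triangle4 _ _ _ _
    linarith
  have hwz : dist z w = dist w z := dist_comm _ _
  have hzy : dist z y = dist y z := dist_comm _ _
  have hyw : dist y w = dist w y := dist_comm _ _
  rcases ht x y z a' b' c ha' hb' hc hmc with ⟨n, hn, hnm⟩ | ⟨n, hn, hnm⟩
  · have := key x y n (ha'.dist_add_dist hn) hnm
    have h2 := le_max_left (dist x y + dist z w) (dist x w + dist z y)
    linarith
  · have := key y z n (hb'.dist_add_dist hn) hnm
    have h2 := le_max_right (dist x y + dist z w) (dist x w + dist z y)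
    linarith

end FourPoint

/-! ### Nearest points on geodesic lines -/

section Nearest

variable {X : Type*} [MetricSpace X] {δ : ℝ} {ℓ ℓ' : ℝ → X}

/-- The point `ℓ s` is a nearest point of the line `ℓ` to `x`. -/
def IsNearest (ℓ : ℝ → X) (x : X) (s : ℝ) : Prop :=
  ∀ u : ℝ, dist x (ℓ s) ≤ dist x (ℓ u)

theorem exists_isNearest (hℓ : Isometry ℓ) (x : X) : ∃ s, IsNearest ℓ x s := by
  have hc : Continuous fun s => dist x (ℓ s) := continuous_const.dist hℓ.continuous
  refine hc.exists_forall_le' 0 ?_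
  rw [← Metric.cobounded_eq_cocompact]
  filter_upwards [(Metric.isBounded_closedBall (x := (0 : ℝ)) (r := 2 * dist x (ℓ 0)))] with s hs
  have h1 : 2 * dist x (ℓ 0) < dist s 0 := by simpa using hs
  have h2 : dist (ℓ s) (ℓ 0) ≤ dist x (ℓ s) + dist x (ℓ 0) := dist_triangle_left _ _ _
  rw [hℓ.dist_eq] at h2
  linarith

/-- A geodesic from `x` to a line nearly passes through the nearest point. -/
theorem IsNearest.add_abs_le (H : FourPoint X δ) (hℓ : Isometry ℓ) {x : X} {s : ℝ}
    (hs : IsNearest ℓ x s) (u : ℝ) : dist x (ℓ s) + |u - s| - 2 * δ ≤ dist x (ℓ u) := by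
  have hd : ∀ a b, dist (ℓ a) (ℓ b) = |a - b| := fun a b => by rw [hℓ.dist_eq, Real.dist_eq]
  -- `e / 2` is the Gromov product of `x` and `ℓ u` at `ℓ s`; the point of the line at this
  -- distance from `ℓ s` towards `ℓ u` is compared with the nearest point.
  set e := dist x (ℓ s) + |u - s| - dist x (ℓ u) with he
  have he0 : 0 ≤ e := by
    have := dist_triangle_right x (ℓ u) (ℓ s)
    have h2 := hd u s
    linarith
  have he1 : e ≤ 2 * |u - s| := by
    have := dist_triangle x (ℓ u) (ℓ s)
    have h2 := hd u s
    linarith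
  obtain ⟨v, hv1, hv2⟩ : ∃ v, |s - v| = e / 2 ∧ |v - u| = |u - s| - e / 2 := by
    rcases le_total s u with h | h
    · rw [abs_of_nonneg (sub_nonneg.2 h)] at he1 ⊢
      refine ⟨s + e / 2, ?_, ?_⟩
      · rw [abs_of_nonpos] <;> linarith
      · rw [abs_of_nonpos] <;> linarith
    · rw [abs_of_nonpos (sub_nonpos.2 h)] at he1 ⊢
      refine ⟨s - e / 2, ?_, ?_⟩
      · rw [abs_of_nonneg] <;> linarith
      · rw [abs_of_nonneg] <;> linarith
  have hm := hs v
  rcases H.le_or x (ℓ v) (ℓ s) (ℓ u) with h | h <;> rw [hd, hd] at h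
  · rw [hv2, abs_sub_comm s u] at h
    linarith
  · rw [abs_sub_comm v s, hv1, abs_sub_comm s u] at h
    linarith

/-- If two points have distant nearest points on a line, then a geodesic between them nearly
follows the line from one nearest point to the other. -/
theorem IsNearest.le_dist (H : FourPoint X δ) (hℓ : Isometry ℓ) {x y : X} {s t : ℝ}
    (hs : IsNearest ℓ x s) (ht : IsNearest ℓ y t) (h : 5 / 2 * δ < |s - t|) :
    dist x (ℓ s) + |s - t| + dist y (ℓ t) - 5 * δ ≤ dist x y := by
  have h1 := hs.add_abs_le H hℓ t
  have h2 := ht.add_abs_le H hℓ s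
  have h3 : dist (ℓ s) (ℓ t) = |s - t| := by rw [hℓ.dist_eq, Real.dist_eq]
  rw [abs_sub_comm] at h1
  rcases H.le_or x (ℓ t) (ℓ s) y with h' | h'
  · rw [dist_comm (ℓ s) y, dist_comm (ℓ t) y] at h'
    linarith
  · rw [dist_comm (ℓ s) y, dist_comm (ℓ t) (ℓ s)] at h'
    linarith

theorem IsNearest.abs_sub_le_dist (H : FourPoint X δ) (hℓ : Isometry ℓ) {x y : X} {s t : ℝ}
    (hs : IsNearest ℓ x s) (ht : IsNearest ℓ y t) : |s - t| ≤ dist x y + 5 * δ := by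
  have hδ := H.nonneg x
  rcases le_or_gt |s - t| (5 / 2 * δ) with h | h
  · linarith [dist_nonneg (x := x) (y := y)]
  · have := hs.le_dist H hℓ ht h
    linarith [dist_nonneg (x := x) (y := ℓ s), dist_nonneg (x := y) (y := ℓ t)]

/-- Behrstock's inequality for two geodesic lines. -/
theorem IsNearest.behrstock (H : FourPoint X δ) (hℓ : Isometry ℓ) (hℓ' : Isometry ℓ') {x : X}
    {s s' t t' : ℝ} (hs : IsNearest ℓ x s) (hs' : IsNearest ℓ' x s')
    (ht : IsNearest ℓ (ℓ' s') t) (ht' : IsNearest ℓ' (ℓ s) t') :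
    |s - t| ≤ 10 * δ ∨ |s' - t'| ≤ 10 * δ := by
  have hδ := H.nonneg x
  by_contra! hcon
  have h1 := hs.le_dist H hℓ ht (by linarith)
  have h2 := hs'.le_dist H hℓ' ht' (by linarith)
  linarith [dist_nonneg (x := ℓ' s') (y := ℓ t), dist_nonneg (x := ℓ s) (y := ℓ' t')]

/-- A point nearly on a geodesic from `x` to `y` is close to the point of that geodesic at the same
distance from `x`. -/
theorem FourPoint.dist_le_of_nearly_between (H : FourPoint X δ) {x y a m : X} {c c' e : ℝ}
    (ha : dist x a + dist a y ≤ dist x y + c) (hm : dist x m + dist m y ≤ dist x y + c')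
    (he : |dist x a - dist x m| ≤ e) :
    dist a m ≤ max c c' + e + δ := by
  obtain ⟨h1, h2⟩ := abs_le.1 he
  have h3 := le_max_left c c'
  have h4 := le_max_right c c'
  rcases H.le_or a m x y with h | h
  · rw [dist_comm a x] at h
    linarith
  · rw [dist_comm m x] at h
    linarith

end Nearest

section Lines

variable {X : Type*} [MetricSpace X] {δ : ℝ} {ℓ ℓ' : ℝ → X}

/-- A geodesic line in some neighbourhood of a second one lies in its `5 * δ`-neighbourhood. -/
theorem IsNearest.dist_le_of_bounded (H : FourPoint X δ) (hℓ : Isometry ℓ) (hℓ' : Isometry ℓ')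
    {M : ℝ} (hM : ∀ t, ∃ s, dist (ℓ' t) (ℓ s) ≤ M) {t s : ℝ} (hs : IsNearest ℓ (ℓ' t) s) :
    dist (ℓ' t) (ℓ s) ≤ 5 * δ := by
  have hδ := H.nonneg (ℓ s)
  have hM0 : 0 ≤ M := by
    obtain ⟨u, hu⟩ := hM t
    exact dist_nonneg.trans hu
  have hMn : ∀ {v α}, IsNearest ℓ (ℓ' v) α → dist (ℓ' v) (ℓ α) ≤ M := fun {v α} hv => by
    obtain ⟨u, hu⟩ := hM v
    exact (hv u).trans hu
  -- points of `ℓ'` on both sides of `ℓ' t`, so far away that their projections are far from `s`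
  set T : ℝ := 2 * M + 5 / 2 * δ + 1 with hT
  obtain ⟨α, hα⟩ := exists_isNearest hℓ (ℓ' (t - T))
  obtain ⟨β, hβ⟩ := exists_isNearest hℓ (ℓ' (t + T))
  have hd : ∀ a b, dist (ℓ a) (ℓ b) = |a - b| := fun a b => by rw [hℓ.dist_eq, Real.dist_eq]
  have hd' : ∀ a b, dist (ℓ' a) (ℓ' b) = |a - b| := fun a b => by rw [hℓ'.dist_eq, Real.dist_eq]
  have hT0 : 0 < T := by positivity
  have far : ∀ {v α}, IsNearest ℓ (ℓ' v) α → dist (ℓ' t) (ℓ' v) = T → 5 / 2 * δ < |s - α| := by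
    intro v α hv h
    have h1 := dist_triangle4 (ℓ' t) (ℓ s) (ℓ α) (ℓ' v)
    rw [hd, dist_comm (ℓ α)] at h1
    linarith [hMn hv, hMn hs]
  have e1 : dist (ℓ' t) (ℓ' (t - T)) = T := by
    rw [hd', sub_sub_cancel, abs_of_pos hT0]
  have e2 : dist (ℓ' t) (ℓ' (t + T)) = T := by
    rw [hd', sub_add_cancel_left, abs_neg, abs_of_pos hT0]
  have h1 := hs.le_dist H hℓ hα (far hα e1)
  have h2 := hs.le_dist H hℓ hβ (far hβ e2)
  have h3 := dist_triangle4 (ℓ' (t - T)) (ℓ α) (ℓ β) (ℓ' (t + T))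
  have e3 : dist (ℓ' (t - T)) (ℓ' (t + T)) = 2 * T := by
    rw [hd', abs_of_nonpos] <;> linarith
  rw [e3, hd, dist_comm (ℓ β)] at h3
  have h4 : |α - β| ≤ |s - α| + |s - β| := by
    rw [abs_sub_comm s α]; exact abs_sub_le _ _ _
  linarith

/-- If the projection of a line `ℓ'` to a line `ℓ` is long, then `ℓ'` follows `ℓ`, in one of the two
directions, along a segment of about the length of the projection. -/
theorem exists_fellow_travel (H : FourPoint X δ) (hℓ : Isometry ℓ) (hℓ' : Isometry ℓ')
    {s t α β : ℝ} (hs : IsNearest ℓ (ℓ' s) α) (ht : IsNearest ℓ (ℓ' t) β)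
    (h : 5 / 2 * δ < |α - β|) :
    ∃ (s₀ α₀ : ℝ) (ε : ℤ), (ε = 1 ∨ ε = -1) ∧
      ∀ τ, 0 ≤ τ → τ ≤ |α - β| - 5 * δ → dist (ℓ' (s₀ + τ)) (ℓ (α₀ + ε * τ)) ≤ 8 * δ := by
  wlog hst : s ≤ t generalizing s t α β
  · rw [abs_sub_comm]
    exact this ht hs (by rwa [abs_sub_comm]) (le_of_not_ge hst)
  have hδ := H.nonneg (ℓ s)
  have hd : ∀ a b, dist (ℓ a) (ℓ b) = |a - b| := fun a b => by rw [hℓ.dist_eq, Real.dist_eq]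
  have hd' : ∀ a b, dist (ℓ' a) (ℓ' b) = |a - b| := fun a b => by rw [hℓ'.dist_eq, Real.dist_eq]
  obtain ⟨ε, hε, hεab⟩ : ∃ ε : ℤ, (ε = 1 ∨ ε = -1) ∧ β - α = ε * |α - β| := by
    rcases le_total α β with h | h
    · exact ⟨1, Or.inl rfl, by rw [abs_of_nonpos (by linarith)]; push_cast; ring⟩
    · exact ⟨-1, Or.inr rfl, by rw [abs_of_nonneg (by linarith)]; push_cast; ring⟩
  have hε1 : |(ε : ℝ)| = 1 := by rcases hε with rfl | rfl <;> simp
  refine ⟨s + dist (ℓ' s) (ℓ α), α, ε, hε, fun τ h0 hτ => ?_⟩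
  have h1 := hs.le_dist H hℓ ht h
  rw [hd' s t, abs_of_nonpos (a := s - t) (by linarith)] at h1
  have a1 : dist (ℓ' s) (ℓ (α + ε * τ)) ≤ dist (ℓ' s) (ℓ α) + τ := by
    have := dist_triangle (ℓ' s) (ℓ α) (ℓ (α + ε * τ))
    rwa [hd, sub_add_cancel_left, abs_neg, abs_mul, hε1, one_mul, abs_of_nonneg h0] at this
  have a2 : dist (ℓ' s) (ℓ α) + τ - 2 * δ ≤ dist (ℓ' s) (ℓ (α + ε * τ)) := by
    have := hs.add_abs_le H hℓ (α + ε * τ)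
    rwa [add_sub_cancel_left, abs_mul, hε1, one_mul, abs_of_nonneg h0] at this
  have a3 : dist (ℓ (α + ε * τ)) (ℓ' t) ≤ |α - β| - τ + dist (ℓ' t) (ℓ β) := by
    have := dist_triangle_right (ℓ (α + ε * τ)) (ℓ' t) (ℓ β)
    rwa [hd, show α + ε * τ - β = -(ε * (|α - β| - τ)) by rw [mul_sub, ← hεab]; ring, abs_neg,
      abs_mul, hε1, one_mul, abs_of_nonneg (by linarith)] at this
  have b1 : dist (ℓ' s) (ℓ' (s + dist (ℓ' s) (ℓ α) + τ)) = dist (ℓ' s) (ℓ α) + τ := by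
    rw [hd', abs_of_nonpos] <;> linarith [dist_nonneg (x := ℓ' s) (y := ℓ α)]
  have b2 : dist (ℓ' (s + dist (ℓ' s) (ℓ α) + τ)) (ℓ' t) = t - s - dist (ℓ' s) (ℓ α) - τ := by
    rw [hd', abs_of_nonpos] <;> linarith [dist_nonneg (x := ℓ' t) (y := ℓ β)]
  have b3 : dist (ℓ' s) (ℓ' t) = t - s := by
    rw [hd', abs_of_nonpos] <;> linarith
  have := H.dist_le_of_nearly_between (x := ℓ' s) (y := ℓ' t) (c := 5 * δ) (c' := 0) (e := 2 * δ)
    (a := ℓ (α + ε * τ)) (m := ℓ' (s + dist (ℓ' s) (ℓ α) + τ)) (by linarith) (by linarith)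
    (by rw [b1, abs_le]; constructor <;> linarith)
  rw [max_eq_left (by linarith), dist_comm] at this
  linarith

end Lines

/-! ### The translates of the axis -/

section Axis

variable {G X : Type*} [Group G] [MetricSpace X] [MulAction G X] {δ : ℝ} {f : G} {γ : ℝ → X}

theorem IsUnitalAxis.zpow_smul (hγ : IsUnitalAxis f γ) (n : ℤ) (t : ℝ) :
    f ^ n • γ t = γ (t + n) := by
  have hinv : ∀ t, f⁻¹ • γ t = γ (t - 1) := fun t => by
    rw [inv_smul_eq_iff, hγ.2, sub_add_cancel]
  induction n generalizing t with
  | zero => simp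
  | succ n ih => rw [zpow_add_one, mul_smul, hγ.2, ih]; congr 1; push_cast; ring
  | pred n ih => rw [zpow_sub_one, mul_smul, hinv, ih]; congr 1; push_cast; ring

theorem IsUnitalAxis.pow_smul (hγ : IsUnitalAxis f γ) (n : ℕ) (t : ℝ) :
    f ^ n • γ t = γ (t + n) := by
  simpa using hγ.zpow_smul (n : ℤ) t

theorem IsUnitalAxis.comp_add_right (hγ : IsUnitalAxis f γ) (t₀ : ℝ) :
    IsUnitalAxis f fun t => γ (t + t₀) :=
  ⟨hγ.1.comp (isometry_add_right t₀), fun t => by rw [hγ.2, add_right_comm]⟩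

/-- The commensurator of the cyclic subgroup generated by `f`: the elements conjugating a nontrivial
power of `f` to a nontrivial power of `f`. When `f` is a WPD element this is the maximal virtually
cyclic subgroup containing `f`. -/
def elementaryClosure (f : G) : Subgroup G where
  carrier := {g | ∃ k l : ℤ, k ≠ 0 ∧ l ≠ 0 ∧ g * f ^ k * g⁻¹ = f ^ l}
  one_mem' := ⟨1, 1, one_ne_zero, one_ne_zero, by simp⟩
  mul_mem' := by
    rintro g h ⟨k, l, hk, hl, e⟩ ⟨m, n, hm, hn, e'⟩
    refine ⟨m * k, l * n, mul_ne_zero hm hk, mul_ne_zero hl hn, ?_⟩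
    calc g * h * f ^ (m * k) * (g * h)⁻¹ = g * (h * f ^ m * h⁻¹) ^ k * g⁻¹ := by
          rw [conj_zpow, zpow_mul]; group
      _ = (g * f ^ k * g⁻¹) ^ n := by
          rw [e', conj_zpow, ← zpow_mul, ← zpow_mul, mul_comm]
      _ = f ^ (l * n) := by rw [e, zpow_mul]
  inv_mem' := by
    rintro g ⟨k, l, hk, hl, e⟩
    exact ⟨l, k, hl, hk, by rw [← e]; group⟩

theorem mem_elementaryClosure {g : G} :
    g ∈ elementaryClosure f ↔ ∃ k l : ℤ, k ≠ 0 ∧ l ≠ 0 ∧ g * f ^ k * g⁻¹ = f ^ l :=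
  Iff.rfl

theorem self_mem_elementaryClosure (f : G) : f ∈ elementaryClosure f :=
  ⟨1, 1, one_ne_zero, one_ne_zero, by group⟩

variable [IsIsometricSMul G X]

theorem isometry_smul_line (hγ : Isometry γ) (h : G) : Isometry fun t => h • γ t :=
  (isometry_smul X h).comp hγ

theorem isNearest_smul_iff {h : G} {x : X} {s : ℝ} :
    IsNearest (fun t => h • γ t) (h • x) s ↔ IsNearest γ x s := by
  simp [IsNearest, dist_smul]

/-- If `g` commensurates `⟨f⟩`, then the distance from `g • γ t` to `γ` is periodic in `t`, hence
bounded, and so the line `g • γ` is uniformly close to `γ`. -/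
theorem IsNearest.dist_le_of_mem_elementaryClosure (H : FourPoint X δ) (hγ : IsUnitalAxis f γ)
    {g : G} (hg : g ∈ elementaryClosure f) {t s : ℝ} (hs : IsNearest γ (g • γ t) s) :
    dist (g • γ t) (γ s) ≤ 5 * δ := by
  obtain ⟨k, l, hk, hl, e⟩ := mem_elementaryClosure.1 hg
  have hk0 : (0 : ℝ) < |(k : ℝ)| := by simpa using hk
  refine IsNearest.dist_le_of_bounded H hγ.1 (isometry_smul_line hγ.1 g)
    (M := |(k : ℝ)| + dist (g • γ 0) (γ 0)) (fun t => ?_) hs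
  -- reduce `t` modulo `k`
  set j : ℤ := ⌊t / k⌋ with hj
  have ht : |t - j * k| ≤ |(k : ℝ)| := by
    have h1 := Int.floor_le (t / k)
    have h2 := (Int.lt_floor_add_one (t / k)).le
    have hk' : (k : ℝ) ≠ 0 := by exact_mod_cast hk
    have : t - j * k = (t / k - j) * k := by field_simp
    rw [this, abs_mul]
    refine mul_le_of_le_one_left hk0.le ?_
    rw [abs_le]; constructor <;> linarith
  refine ⟨((j * l : ℤ) : ℝ), ?_⟩
  have e1 : g • γ t = f ^ (j * l) • g • γ (t - j * k) := by
    have : f ^ (j * l) * g = g * f ^ (j * k) := by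
      rw [mul_comm j l, zpow_mul, ← e, conj_zpow, ← zpow_mul, mul_comm k j]; group
    rw [← mul_smul, this, mul_smul, hγ.zpow_smul]
    congr 2; push_cast; ring
  have e2 : γ ((j * l : ℤ) : ℝ) = f ^ (j * l) • γ 0 := by rw [hγ.zpow_smul, zero_add]
  rw [e1, e2, dist_smul]
  refine (dist_triangle _ (g • γ 0) _).trans ?_
  rw [dist_smul, hγ.1.dist_eq, Real.dist_eq, sub_zero]
  linarith

/-- Two translates of the axis of a WPD element with long projections to each other are parallel:
if `h • γ` follows `γ` for a long time, then the elements `f ^ (∓ n) * h * f ^ n` move two distant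
points of the axis almost in the same way, so two of them coincide. -/
theorem exists_overlap_bound (H : FourPoint X δ) (hγ : IsUnitalAxis f γ) (hf : IsWPD f (γ 0)) :
    ∃ θ : ℝ, ∀ h ∉ elementaryClosure f, ∀ s t α β : ℝ, IsNearest γ (h • γ s) α →
      IsNearest γ (h • γ t) β → |α - β| ≤ θ := by
  have hδ := H.nonneg (γ 0)
  obtain ⟨N, hN0, hN⟩ := hf (2 * (8 * δ + 1) + 1) (by positivity)
  set F := hN.toFinset with hF
  refine ⟨N + F.card + 5 * δ + 2, fun h hh s t α β hα hβ => ?_⟩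
  by_contra! hlong
  apply hh
  have hcard : (0 : ℝ) ≤ F.card := Nat.cast_nonneg _
  have hNn : (0 : ℝ) ≤ N := Nat.cast_nonneg _
  obtain ⟨s₀, α₀, ε, hε, hft⟩ := exists_fellow_travel H hγ.1 (isometry_smul_line hγ.1 h) hα hβ
    (by linarith)
  have hε1 : |(ε : ℝ)| = 1 := by rcases hε with rfl | rfl <;> simp
  have hε0 : ε ≠ 0 := by rcases hε with rfl | rfl <;> norm_num
  -- shift by powers of `f` so that both segments start near `γ 0`
  set b : ℤ := ⌈s₀⌉ with hb
  have hb1 := Int.le_ceil s₀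
  have hb2 := Int.ceil_lt_add_one s₀
  set a : ℤ := ⌊α₀ + ε * (b - s₀)⌋ with ha
  have ha1 := Int.floor_le (α₀ + ε * (b - s₀))
  have ha2 := Int.lt_floor_add_one (α₀ + ε * (b - s₀))
  obtain ⟨k, hk⟩ : ∃ k, k = f ^ (-a) * h * f ^ b := ⟨_, rfl⟩
  have near : ∀ n : ℕ, n ≤ N + F.card → dist (k • γ n) (γ (ε * n)) ≤ 8 * δ + 1 := by
    intro n hn
    have hn' : (n : ℝ) ≤ N + F.card := by exact_mod_cast hn
    have hn0 : (0 : ℝ) ≤ n := Nat.cast_nonneg _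
    have h1 := hft (b - s₀ + n) (by linarith) (by linarith)
    have e1 : k • γ n = f ^ (-a) • h • γ (s₀ + (b - s₀ + n)) := by
      rw [hk, mul_smul, mul_smul, hγ.zpow_smul]; congr 3; ring
    have e2 : f ^ (-a) • γ (α₀ + ε * (b - s₀ + n)) = γ (α₀ + ε * (b - s₀ + n) - a) := by
      rw [hγ.zpow_smul]; congr 1; push_cast; ring
    have h2 : dist (k • γ n) (γ (α₀ + ε * (b - s₀ + n) - a)) ≤ 8 * δ := by
      rw [e1, ← e2, dist_smul]; exact h1
    have h3 : dist (γ (α₀ + ε * (b - s₀ + n) - a)) (γ (ε * n)) ≤ 1 := by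
      rw [hγ.1.dist_eq, Real.dist_eq, abs_le]; constructor <;> linarith
    linarith [dist_triangle (k • γ n) (γ (α₀ + ε * (b - s₀ + n) - a)) (γ (ε * n))]
  have hmem : ∀ n ∈ Finset.range (F.card + 1), k⁻¹ * (f ^ (-(ε * n)) * k * f ^ (n : ℤ)) ∈ F := by
    intro n hn
    rw [Finset.mem_range] at hn
    have key : ∀ m : ℕ, m ≤ N →
        dist (γ m) ((k⁻¹ * (f ^ (-(ε * n)) * k * f ^ (n : ℤ))) • γ m) ≤ 2 * (8 * δ + 1) := by
      intro m hm
      have h1 := near m (by omega)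
      have h2 := near (m + n) (by omega)
      have e1 : dist (γ m) ((k⁻¹ * (f ^ (-(ε * n)) * k * f ^ (n : ℤ))) • γ m) =
          dist (k • γ m) (f ^ (-(ε * n)) • k • γ ((m + n : ℕ) : ℝ)) := by
        rw [← dist_smul k]
        congr 1
        rw [mul_smul, smul_inv_smul, mul_smul, mul_smul, hγ.zpow_smul]
        push_cast; rfl
      have e2 : f ^ (-(ε * n)) • γ (ε * ((m + n : ℕ) : ℝ)) = γ (ε * m) := by
        rw [hγ.zpow_smul]; congr 1; push_cast; ring
      rw [← dist_smul (f ^ (-(ε * (n : ℤ)))), e2] at h2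
      rw [e1]
      linarith [dist_triangle_right (k • γ m) (f ^ (-(ε * n)) • k • γ ((m + n : ℕ) : ℝ))
        (γ (ε * m))]
    rw [hF, Set.Finite.mem_toFinset]
    refine ⟨?_, ?_⟩
    · have := key 0 (Nat.zero_le _)
      rw [Nat.cast_zero] at this
      linarith
    · have := key N le_rfl
      rw [hγ.pow_smul, zero_add]
      linarith
  obtain ⟨n, -, m, -, hnm, heq⟩ := Finset.exists_ne_map_eq_of_card_lt_of_maps_to
    (by rw [Finset.card_range]; omega) hmem
  have hkE : k ∈ elementaryClosure f := by
    refine ⟨n - m, ε * (n - m), ?_, ?_, ?_⟩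
    · intro h0; apply hnm; omega
    · refine mul_ne_zero hε0 ?_
      intro h0; apply hnm; omega
    · have h1 := mul_left_cancel heq
      have h2 : k * f ^ (n : ℤ) = f ^ (ε * n) * (f ^ (-(ε * m)) * k * f ^ (m : ℤ)) := by
        rw [← h1]; group
      rw [zpow_sub, ← mul_assoc, h2, mul_sub, zpow_sub]; group
  have hfE := self_mem_elementaryClosure f
  have : h = f ^ a * k * f ^ (-b) := by rw [hk]; group
  rw [this]
  exact mul_mem (mul_mem (zpow_mem hfE _) hkE) (zpow_mem hfE _)

/-- `⟨f⟩` has finite index in its commensurator. -/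
theorem exists_finite_forall_mem_elementaryClosure (H : FourPoint X δ) (hγ : IsUnitalAxis f γ)
    (hf : IsWPD f (γ 0)) :
    ∃ Q : Set G, Q.Finite ∧ ∀ g ∈ elementaryClosure f, ∃ n : ℤ, ∃ q ∈ Q, g = f ^ n * q := by
  have hδ := H.nonneg (γ 0)
  obtain ⟨N, hN0, hN⟩ := hf (2 * (15 * δ + 2)) (by positivity)
  set F := {g : G | dist (γ 0) (g • γ 0) < 2 * (15 * δ + 2) ∧
    dist (f ^ N • γ 0) (g • f ^ N • γ 0) < 2 * (15 * δ + 2)} with hF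
  have hfN : f ^ N • γ 0 = γ N := by rw [hγ.pow_smul, zero_add]
  have hNn : (0 : ℝ) ≤ N := Nat.cast_nonneg _
  -- up to a power of `f`, an element of the commensurator fixes or flips the axis, coarsely
  have shift : ∀ g ∈ elementaryClosure f, ∃ (n : ℤ) (q : G), g = f ^ n * q ∧
      dist (q • γ 0) (γ 0) ≤ 15 * δ + 1 ∧
      (dist (q • γ N) (γ N) ≤ 15 * δ + 1 ∨ dist (q • γ N) (γ (-N)) ≤ 15 * δ + 1) := by
    intro g hg
    obtain ⟨α, hα⟩ := exists_isNearest hγ.1 (g • γ 0)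
    have h1 := hα.dist_le_of_mem_elementaryClosure H hγ hg
    set q : G := f ^ (-⌊α⌋) * g with hq
    have hqE : q ∈ elementaryClosure f :=
      mul_mem (zpow_mem (self_mem_elementaryClosure f) _) hg
    have h2 : dist (q • γ 0) (γ 0) ≤ 5 * δ + 1 := by
      have e : f ^ (-⌊α⌋) • γ α = γ (α - ⌊α⌋) := by
        rw [hγ.zpow_smul]; congr 1; push_cast; ring
      rw [← dist_smul (f ^ (-⌊α⌋)), ← mul_smul, e] at h1
      have h3 : dist (γ (α - ⌊α⌋)) (γ 0) ≤ 1 := by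
        rw [hγ.1.dist_eq, Real.dist_eq, abs_le]
        constructor <;> linarith [Int.floor_le α, Int.lt_floor_add_one α]
      linarith [dist_triangle (q • γ 0) (γ (α - ⌊α⌋)) (γ 0)]
    obtain ⟨β, hβ⟩ := exists_isNearest hγ.1 (q • γ N)
    have h3 := hβ.dist_le_of_mem_elementaryClosure H hγ hqE
    have e1 : dist (q • γ N) (q • γ 0) = N := by
      rw [dist_smul, hγ.1.dist_eq, Real.dist_eq, sub_zero, abs_of_nonneg hNn]
    have e2 : dist (γ β) (γ 0) = |β| := by rw [hγ.1.dist_eq, Real.dist_eq, sub_zero]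
    have h4 := dist_triangle4 (q • γ N) (γ β) (γ 0) (q • γ 0)
    have h5 := dist_triangle4 (γ β) (q • γ N) (q • γ 0) (γ 0)
    rw [dist_comm (γ 0) (q • γ 0)] at h4
    rw [dist_comm (γ β) (q • γ N)] at h5
    refine ⟨⌊α⌋, q, by rw [hq]; group, by linarith, ?_⟩
    rcases le_total 0 β with h | h
    · left
      rw [abs_of_nonneg h] at e2
      have h6 : dist (γ β) (γ N) ≤ 10 * δ + 1 := by
        rw [hγ.1.dist_eq, Real.dist_eq, abs_le]; constructor <;> linarith
      linarith [dist_triangle (q • γ N) (γ β) (γ N)]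
    · right
      rw [abs_of_nonpos h] at e2
      have h6 : dist (γ β) (γ (-N)) ≤ 10 * δ + 1 := by
        rw [hγ.1.dist_eq, Real.dist_eq, abs_le]; constructor <;> linarith
      linarith [dist_triangle (q • γ N) (γ β) (γ (-N))]
  by_cases hflip : ∃ q₀ : G, dist (q₀ • γ 0) (γ 0) ≤ 15 * δ + 1 ∧
      dist (q₀ • γ N) (γ (-N)) ≤ 15 * δ + 1
  · obtain ⟨q₀, ha, hb⟩ := hflip
    refine ⟨F ∪ (fun q => q₀ * q) '' F, hN.union (hN.image _), fun g hg => ?_⟩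
    obtain ⟨n, q, rfl, h1, h2 | h2⟩ := shift g hg
    · refine ⟨n, q, Or.inl ⟨?_, ?_⟩, rfl⟩
      · rw [dist_comm]; linarith
      · rw [hfN, dist_comm]; linarith
    · refine ⟨n, q, Or.inr ⟨q₀⁻¹ * q, ⟨?_, ?_⟩, by group⟩, rfl⟩
      · rw [← dist_smul q₀, mul_smul, smul_inv_smul]
        linarith [dist_triangle_right (q₀ • γ 0) (q • γ 0) (γ 0)]
      · rw [hfN, ← dist_smul q₀, mul_smul, smul_inv_smul]
        linarith [dist_triangle_right (q₀ • γ N) (q • γ N) (γ (-N))]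
  · refine ⟨F, hN, fun g hg => ?_⟩
    obtain ⟨n, q, rfl, h1, h2 | h2⟩ := shift g hg
    · refine ⟨n, q, ⟨?_, ?_⟩, rfl⟩
      · rw [dist_comm]; linarith
      · rw [hfN, dist_comm]; linarith
    · exact absurd ⟨q, h1, h2⟩ hflip

/-- `⟨f⟩` has finite index in its commensurator, but not in a group that is not virtually cyclic. -/
theorem infinite_quotient_elementaryClosure (H : FourPoint X δ) (hγ : IsUnitalAxis f γ)
    (hf : IsWPD f (γ 0)) (hG : ¬ IsVirtuallyCyclic G) : Infinite (G ⧸ elementaryClosure f) := by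
  by_contra hfin
  rw [not_infinite_iff_finite] at hfin
  obtain ⟨Q, hQ, hE⟩ := exists_finite_forall_mem_elementaryClosure H hγ hf
  have := hQ.to_subtype
  apply hG
  refine ⟨Subgroup.zpowers f, inferInstance, ?_⟩
  have : Finite (G ⧸ Subgroup.zpowers f) := by
    refine Finite.of_surjective (α := (G ⧸ elementaryClosure f) × Q)
      (fun x => ((x.1.out * (x.2 : G)⁻¹ : G) : G ⧸ Subgroup.zpowers f)) fun y => ?_
    induction y using QuotientGroup.induction_on with
    | H g =>
      have h1 : g⁻¹ * (g : G ⧸ elementaryClosure f).out ∈ elementaryClosure f :=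
        QuotientGroup.eq.1 (QuotientGroup.out_eq' _).symm
      obtain ⟨n, q, hq, e⟩ := hE _ h1
      refine ⟨⟨g, ⟨q, hq⟩⟩, ?_⟩
      rw [QuotientGroup.eq]
      refine ⟨-n, ?_⟩
      have : (g : G ⧸ elementaryClosure f).out = g * (f ^ n * q) := by rw [← e]; group
      simp only [this]
      group
  exact Subgroup.finiteIndex_of_finite_quotient

end Axis

/-! ### Projection families and their trees of axes -/

/-- A family of axes, seen from a base point `p`. The number `depth Y x` measures how long a
geodesic from `p` to `x` follows the axis `Y`, and `gate Y` is the point where geodesics from `p`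
enter `Y`. -/
structure ProjectionFamily {X : Type*} [MetricSpace X] (A : Type*) (p : X) (θ : ℝ) where
  /-- How long a geodesic from `p` to the given point follows the given axis. -/
  depth : A → X → ℝ
  /-- The point at which geodesics from `p` enter the given axis. -/
  gate : A → X
  nonneg : 0 ≤ θ
  depth_base : ∀ Y, depth Y p = 0
  depth_gate : ∀ Y, depth Y (gate Y) = 0
  behrstock : ∀ Y Z, Y ≠ Z → ∀ x,
    |depth Y x - depth Y (gate Z)| ≤ θ ∨ |depth Z x - depth Z (gate Y)| ≤ θ
  le_dist : ∀ Y x, θ < depth Y x → dist p (gate Y) + depth Y x - θ ≤ dist p x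

namespace ProjectionFamily

variable {X A : Type*} [MetricSpace X] {p : X} {θ K : ℝ} (P : ProjectionFamily A p θ)

theorem depth_gate_le (Y Z : A) (h : Y ≠ Z) :
    P.depth Y (P.gate Z) ≤ θ ∨ P.depth Z (P.gate Y) ≤ θ := by
  rcases P.behrstock Y Z h p with h | h <;> rw [P.depth_base, zero_sub, abs_neg] at h
  · exact Or.inl ((le_abs_self _).trans h)
  · exact Or.inr ((le_abs_self _).trans h)

/-- The axis `Y` is the last one among those which a geodesic from `p` to `x` follows at least for
the length `K`. Passing from `x` to the gate of its parent turns the axes into a forest. -/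
def IsParent (K : ℝ) (x : X) (Y : A) : Prop :=
  K ≤ P.depth Y x ∧ ∀ Z, Z ≠ Y → K ≤ P.depth Z x → θ < P.depth Z (P.gate Y)

variable {P}

theorem IsParent.unique {x : X} {Y Z : A} (hY : P.IsParent K x Y) (hZ : P.IsParent K x Z) :
    Y = Z := by
  by_contra h
  have h1 := hY.2 Z (Ne.symm h) hZ.1
  have h2 := hZ.2 Y h hY.1
  rcases P.depth_gate_le Y Z h with h | h <;> linarith

theorem IsParent.dist_gate_le (hK : 3 * θ + 1 ≤ K) {x : X} {Y : A} (hY : P.IsParent K x Y) :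
    dist p (P.gate Y) ≤ dist p x - 1 := by
  have := P.nonneg
  have h1 := P.le_dist Y x (by linarith [hY.1])
  linarith [hY.1]

theorem exists_isParent (hK : 3 * θ + 1 ≤ K) {x : X} {Y : A} (hY : K ≤ P.depth Y x) :
    ∃ Z, P.IsParent K x Z := by
  have hθ := P.nonneg
  set s : Set ℝ := {r | ∃ Z, K ≤ P.depth Z x ∧ r = dist p (P.gate Z)} with hs
  have hbdd : BddAbove s := by
    refine ⟨dist p x, ?_⟩
    rintro r ⟨Z, hZ, rfl⟩
    have := P.le_dist Z x (by linarith)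
    linarith
  -- gates of distinct axes deep on the way to `x` differ in their distance to `p` by at least `1`
  obtain ⟨_, ⟨W, hW, rfl⟩, hlt⟩ := exists_lt_of_lt_csSup (s := s) ⟨_, Y, hY, rfl⟩
    (show sSup s - 1 < sSup s by linarith)
  refine ⟨W, hW, fun Z hZW hZ => ?_⟩
  rcases P.behrstock Z W hZW x with h | h
  · linarith [(abs_le.1 h).2]
  · have h1 := (abs_le.1 h).2
    have h2 := P.le_dist W (P.gate Z) (by linarith)
    have h3 := le_csSup hbdd ⟨Z, hZ, rfl⟩
    linarith

variable (P) in
/-- `IsRoot K x R` says that `R` is the last axis on the way from `x` towards `p` in the forest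
given by `IsParent K`. -/
inductive IsRoot (K : ℝ) : X → A → Prop
  | last {x : X} {Y : A} : P.IsParent K x Y → (∀ Z, ¬ P.IsParent K (P.gate Y) Z) → IsRoot K x Y
  | step {x : X} {Y R : A} : P.IsParent K x Y → IsRoot K (P.gate Y) R → IsRoot K x R

theorem exists_isRoot (hK : 3 * θ + 1 ≤ K) {x : X} {Y : A} (hY : P.IsParent K x Y) :
    ∃ R, P.IsRoot K x R := by
  obtain ⟨n, hn⟩ := exists_nat_ge (dist p x)
  induction n generalizing x Y with
  | zero =>
    have := hY.dist_gate_le hK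
    simp only [Nat.cast_zero] at hn
    linarith [dist_nonneg (x := p) (y := P.gate Y)]
  | succ n ih =>
    by_cases h : ∃ Z, P.IsParent K (P.gate Y) Z
    · obtain ⟨Z, hZ⟩ := h
      have := hY.dist_gate_le hK
      push_cast at hn
      obtain ⟨R, hR⟩ := ih hZ (by linarith)
      exact ⟨R, .step hY hR⟩
    · exact ⟨Y, .last hY (not_exists.1 h)⟩

variable (P) in
/-- `R` is the root of the tree containing the axis `Z`. -/
def IsRootOfAxis (K : ℝ) (Z R : A) : Prop :=
  (∀ W, ¬ P.IsParent K (P.gate Z) W) ∧ R = Z ∨ P.IsRoot K (P.gate Z) R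

theorem IsParent.isRoot_iff {x : X} {Y R : A} (hY : P.IsParent K x Y) :
    P.IsRoot K x R ↔ P.IsRootOfAxis K Y R := by
  constructor
  · rintro (⟨h1, h2⟩ | ⟨h1, h2⟩)
    · obtain rfl := hY.unique h1
      exact Or.inl ⟨h2, rfl⟩
    · obtain rfl := hY.unique h1
      exact Or.inr h2
  · rintro (⟨h1, rfl⟩ | h)
    · exact .last hY h1
    · exact .step hY h

/-- Every axis `Z` followed by more than `K + θ` on the way to `x` is an ancestor of `x`. The errors
do not accumulate along the chain of ancestors `W` of `x`, since each of them is compared with `x`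
itself: the depth of `x` in `W` is at least `K - θ`. -/
theorem isRoot_iff_isRootOfAxis (hK : 3 * θ + 1 ≤ K) {x : X} {Z R : A}
    (hZ : K + θ ≤ P.depth Z x) : P.IsRoot K x R ↔ P.IsRootOfAxis K Z R := by
  have hθ := P.nonneg
  have key : ∀ n : ℕ, ∀ W, dist p (P.gate W) ≤ n → K - θ ≤ P.depth W x → Z ≠ W →
      θ < P.depth Z (P.gate W) → (P.IsRootOfAxis K W R ↔ P.IsRootOfAxis K Z R) := by
    intro n
    induction n with
    | zero =>
      intro W hn _ _ h
      have := P.le_dist Z _ h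
      simp only [Nat.cast_zero] at hn
      linarith [dist_nonneg (x := p) (y := P.gate Z)]
    | succ n ih =>
      intro W hn hWx hZW hlt
      have hWZ : P.depth W (P.gate Z) ≤ θ := (P.depth_gate_le Z W hZW).resolve_left (by linarith)
      have hKZ : K ≤ P.depth Z (P.gate W) := by
        rcases P.behrstock Z W hZW x with h | h
        · linarith [(abs_le.1 h).2]
        · linarith [(abs_le.1 h).2]
      obtain ⟨V, hV⟩ := exists_isParent hK hKZ
      have hnot : P.IsRootOfAxis K W R ↔ P.IsRoot K (P.gate W) R :=
        ⟨fun h => h.resolve_left fun h' => h'.1 V hV, Or.inr⟩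
      rw [hnot, hV.isRoot_iff]
      by_cases hVZ : Z = V
      · rw [hVZ]
      have hVW : V ≠ W := by
        rintro rfl
        have := hV.1
        rw [P.depth_gate] at this
        linarith
      refine ih V ?_ ?_ hVZ (hV.2 Z hVZ hKZ)
      · have := hV.dist_gate_le hK
        push_cast at hn
        linarith
      · have h1 : P.depth W (P.gate V) ≤ θ :=
          (P.depth_gate_le V W hVW).resolve_left (by linarith [hV.1])
        rcases P.behrstock V W hVW x with h | h
        · linarith [(abs_le.1 h).1, hV.1]
        · linarith [(abs_le.1 h).2]
  obtain ⟨W, hW⟩ := exists_isParent hK (show K ≤ P.depth Z x by linarith)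
  rw [hW.isRoot_iff]
  by_cases hZW : Z = W
  · rw [hZW]
  obtain ⟨n, hn⟩ := exists_nat_ge (dist p (P.gate W))
  exact key n W hn (by linarith [hW.1]) hZW (hW.2 Z hZW (by linarith))

theorem IsRoot.le_depth (hK : 3 * θ + 1 ≤ K) {x : X} {R : A} (hR : P.IsRoot K x R) :
    K - θ ≤ P.depth R x := by
  have hθ := P.nonneg
  have key : ∀ x₁ R, P.IsRoot K x₁ R → (∀ Y, K ≤ P.depth Y x₁ → K - θ ≤ P.depth Y x) →
      K - θ ≤ P.depth R x := by
    intro x₁ R h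
    induction h with
    | last h1 _ => exact fun h => h _ h1.1
    | @step x₁ W R h1 _ ih =>
      refine fun h => ih fun V hV => ?_
      have hVW : V ≠ W := by
        rintro rfl
        rw [P.depth_gate] at hV
        linarith
      have hWx := h W h1.1
      have h1 : P.depth W (P.gate V) ≤ θ :=
        (P.depth_gate_le V W hVW).resolve_left (by linarith)
      rcases P.behrstock V W hVW x with h | h
      · linarith [(abs_le.1 h).1]
      · linarith [(abs_le.1 h).2]
  exact key x R hR fun Y hY => by linarith

end ProjectionFamily

/-! ### The projection family of the translates of an axis -/

section Family

variable {X : Type*} [MetricSpace X] {δ : ℝ} {ℓ ℓ' : ℝ → X}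

/-- The parameter of a chosen nearest point of the line `ℓ` to `x`. -/
noncomputable def nearestParam (ℓ : ℝ → X) (x : X) : ℝ :=
  Classical.epsilon (IsNearest ℓ x)

theorem isNearest_nearestParam (hℓ : Isometry ℓ) (x : X) : IsNearest ℓ x (nearestParam ℓ x) :=
  Classical.epsilon_spec (exists_isNearest hℓ x)

theorem nearestParam_self (hℓ : Isometry ℓ) (s : ℝ) : nearestParam ℓ (ℓ s) = s := by
  have h := isNearest_nearestParam hℓ (ℓ s) s
  rw [dist_self] at h
  exact (hℓ.injective (dist_le_zero.1 h)).symm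

/-- Lines at distance at most `5 * δ` from each other have nearby nearest points. -/
theorem IsNearest.dist_le_of_parallel (H : FourPoint X δ) (hℓ : Isometry ℓ)
    (h₁ : ∀ t, ∃ s, dist (ℓ t) (ℓ' s) ≤ 5 * δ) (h₂ : ∀ t, ∃ s, dist (ℓ' t) (ℓ s) ≤ 5 * δ)
    {x : X} {a a' : ℝ} (ha : IsNearest ℓ x a) (ha' : IsNearest ℓ' x a') :
    dist (ℓ a) (ℓ' a') ≤ 17 * δ := by
  obtain ⟨s, hs⟩ := h₂ a'
  obtain ⟨u, hu⟩ := h₁ a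
  have h1 := ha.add_abs_le H hℓ s
  have h2 := ha' u
  have h3 := dist_triangle x (ℓ' a') (ℓ s)
  have h4 := dist_triangle x (ℓ a) (ℓ' u)
  have h5 : dist (ℓ a) (ℓ s) = |s - a| := by rw [dist_comm, hℓ.dist_eq, Real.dist_eq]
  have h6 := dist_triangle_right (ℓ a) (ℓ' a') (ℓ s)
  linarith

variable {G : Type*} [Group G] [MulAction G X] [IsIsometricSMul G X] {f : G} {γ : ℝ → X}

/-- The line `h • γ`, where `h` is a chosen representative of a coset of the elementary closure
of `f`. -/
noncomputable def cosetLine (f : G) (γ : ℝ → X) (Y : G ⧸ elementaryClosure f) (t : ℝ) : X :=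
  Y.out • γ t

theorem isometry_cosetLine (hγ : Isometry γ) (Y : G ⧸ elementaryClosure f) :
    Isometry (cosetLine f γ Y) :=
  isometry_smul_line hγ _

theorem abs_signedPart_sub_le (ε : ℤˣ) (a b c : ℝ) :
    |max 0 (((ε : ℤ) : ℝ) * (a - c)) - max 0 (((ε : ℤ) : ℝ) * (b - c))| ≤ |a - b| := by
  have hε : |((ε : ℤ) : ℝ)| = 1 := by rcases Int.units_eq_one_or ε with h | h <;> simp [h]
  rw [max_comm 0, max_comm 0]
  refine (abs_max_sub_max_le_abs _ _ _).trans_eq ?_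
  rw [← mul_sub, abs_mul, hε, one_mul, sub_sub_sub_cancel_right]

/-- The oriented translates of the axis of `f`, one for each coset of the elementary closure of `f`
and each orientation, seen from a base point. The depth is the signed length of the projection of
the segment to the axis, so it vanishes for points projecting backwards. -/
noncomputable def axisFamily (H : FourPoint X δ) (hγ : IsUnitalAxis f γ) {θ : ℝ} (hθ : 0 ≤ θ)
    (hover : ∀ h ∉ elementaryClosure f, ∀ s t α β : ℝ, IsNearest γ (h • γ s) α →
      IsNearest γ (h • γ t) β → |α - β| ≤ θ) (p : X) :
    ProjectionFamily ((G ⧸ elementaryClosure f) × ℤˣ) p (10 * δ + θ) where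
  depth Y x := max 0 (((Y.2 : ℤ) : ℝ) *
    (nearestParam (cosetLine f γ Y.1) x - nearestParam (cosetLine f γ Y.1) p))
  gate Y := cosetLine f γ Y.1 (nearestParam (cosetLine f γ Y.1) p)
  nonneg := by have := H.nonneg p; positivity
  depth_base Y := by simp
  depth_gate Y := by simp [nearestParam_self (isometry_cosetLine hγ.1 _)]
  le_dist Y x h := by
    have hδ := H.nonneg p
    have hi := isometry_cosetLine (f := f) hγ.1 Y.1
    set ℓ := cosetLine f γ Y.1
    have hε : |((Y.2 : ℤ) : ℝ)| = 1 := by rcases Int.units_eq_one_or Y.2 with h | h <;> simp [h]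
    have h1 : max 0 (((Y.2 : ℤ) : ℝ) * (nearestParam ℓ x - nearestParam ℓ p)) ≤
        |nearestParam ℓ p - nearestParam ℓ x| := by
      refine max_le (abs_nonneg _) ((le_abs_self _).trans ?_)
      rw [abs_mul, hε, one_mul, abs_sub_comm]
    have h2 := (isNearest_nearestParam hi p).le_dist H hi (isNearest_nearestParam hi x)
      (by linarith)
    linarith [dist_nonneg (x := x) (y := ℓ (nearestParam ℓ x))]
  behrstock := by
    rintro ⟨Y, ε⟩ ⟨Z, η⟩ hne x
    have hδ := H.nonneg p
    have hiY := isometry_cosetLine (f := f) hγ.1 Y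
    have hiZ := isometry_cosetLine (f := f) hγ.1 Z
    by_cases hYZ : Y = Z
    · subst hYZ
      have hη : ((η : ℤ) : ℝ) = -((ε : ℤ) : ℝ) := by
        rcases Int.units_eq_one_or ε with rfl | rfl <;> rcases Int.units_eq_one_or η with rfl | rfl
        all_goals first | exact absurd rfl hne | simp
      simp only [nearestParam_self hiY, sub_self, mul_zero, max_self, sub_zero, hη, neg_mul]
      rcases le_total 0 (((ε : ℤ) : ℝ) *
        (nearestParam (cosetLine f γ Y) x - nearestParam (cosetLine f γ Y) p)) with h | h
      · right
        rw [max_eq_left (by linarith), abs_zero]; positivity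
      · left
        rw [max_eq_left h, abs_zero]; positivity
    · have hov : ∀ {U V : G ⧸ elementaryClosure f}, U ≠ V → ∀ s t : ℝ,
          |nearestParam (cosetLine f γ U) (cosetLine f γ V s) -
            nearestParam (cosetLine f γ U) (cosetLine f γ V t)| ≤ θ := by
        intro U V hUV s t
        have hiU := isometry_cosetLine (f := f) hγ.1 U
        have hnot : U.out⁻¹ * V.out ∉ elementaryClosure f := by
          rw [← QuotientGroup.eq, QuotientGroup.out_eq', QuotientGroup.out_eq']
          exact hUV
        have hn : ∀ s, IsNearest γ ((U.out⁻¹ * V.out) • γ s)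
            (nearestParam (cosetLine f γ U) (cosetLine f γ V s)) := by
          intro s
          rw [← isNearest_smul_iff (h := U.out), mul_smul, smul_inv_smul]
          exact isNearest_nearestParam hiU _
        exact hover _ hnot s t _ _ (hn s) (hn t)
      rcases (isNearest_nearestParam hiY x).behrstock H hiY hiZ (isNearest_nearestParam hiZ x)
        (isNearest_nearestParam hiY _) (isNearest_nearestParam hiZ _) with h | h
      · left
        exact (abs_signedPart_sub_le _ _ _ _).trans
          ((abs_sub_le _ _ _).trans (add_le_add h (hov hYZ _ _)))
      · right
        refine (abs_signedPart_sub_le _ _ _ _).trans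
          ((abs_sub_le _ _ _).trans (add_le_add h (hov (Ne.symm hYZ) _ _)))

end Family

/-! ### Barriers -/

section Barrier

variable {X : Type*} [MetricSpace X] {δ : ℝ} {ℓ : ℝ → X}

theorem abs_gromovProduct_sub_le (o x x' y : X) :
    |gromovProduct o x y - gromovProduct o x' y| ≤ dist x x' := by
  have h1 := dist_triangle o x x'
  have h2 := dist_triangle_right o x x'
  have h3 := dist_triangle x x' y
  have h4 := dist_triangle_left x' y x
  unfold gromovProduct
  rw [abs_le]; constructor <;> linarith

theorem gromovProduct_le_dist (o x y : X) : gromovProduct o x y ≤ dist o y := by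
  have := dist_triangle o y x
  have h := dist_comm x y
  unfold gromovProduct
  linarith

/-- A geodesic from `o` to `y` separates, at its point `p`, the points which leave it before `p`
from those which leave it after `p`. -/
theorem gromovProduct_le_of_le_of_le (H : FourPoint X δ) {o y p x x' : X} {c : ℝ} (hc : δ < c)
    (hp : dist o p + dist p y = dist o y) (hx : gromovProduct o x y ≤ dist o p - c)
    (hx' : dist o p + c ≤ gromovProduct o x' y) : gromovProduct p x x' ≤ δ := by
  have hδ := H.nonneg o
  have := dist_comm p x
  have := dist_comm p x'
  have := dist_comm p y
  have := dist_comm x y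
  have := dist_comm x' y
  have := dist_comm x x'
  have t1 := dist_triangle x p y
  have t2 := dist_triangle o p x'
  unfold gromovProduct at *
  rcases H.le_or o y x p with h | h <;> rcases H.le_or x y p x' with h' | h' <;>
    linarith [dist_comm y x, dist_comm y x', dist_comm y p, dist_comm x' p, dist_comm x p]

/-- If the segments from `p` to `x` and to `x'` both project to long segments of a line `ℓ` in the
same direction, then they stay together for a long time. -/
theorem le_gromovProduct_of_signedPart (H : FourPoint X δ) (hℓ : Isometry ℓ) {p x x' : X}
    {a b b' c : ℝ} (ε : ℤˣ) (ha : IsNearest ℓ p a) (hb : IsNearest ℓ x b)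
    (hb' : IsNearest ℓ x' b') (hc : 5 / 2 * δ < c) (h : c ≤ max 0 (((ε : ℤ) : ℝ) * (b - a)))
    (h' : c ≤ max 0 (((ε : ℤ) : ℝ) * (b' - a))) : c - 5 * δ ≤ gromovProduct p x x' := by
  have hδ := H.nonneg p
  have hc0 : 0 < c := by linarith
  have h := (le_max_iff.1 h).resolve_left (by linarith)
  have h' := (le_max_iff.1 h').resolve_left (by linarith)
  have e1 : |a - b| = ((ε : ℤ) : ℝ) * (b - a) := by
    rcases Int.units_eq_one_or ε with rfl | rfl <;> simp only [Units.val_one, Units.val_neg,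
      Int.cast_neg, Int.cast_one, one_mul, neg_mul] at h ⊢
    · rw [abs_of_nonpos] <;> linarith
    · rw [abs_of_nonneg] <;> linarith
  have e2 : |a - b'| = ((ε : ℤ) : ℝ) * (b' - a) := by
    rcases Int.units_eq_one_or ε with rfl | rfl <;> simp only [Units.val_one, Units.val_neg,
      Int.cast_neg, Int.cast_one, one_mul, neg_mul] at h' ⊢
    · rw [abs_of_nonpos] <;> linarith
    · rw [abs_of_nonneg] <;> linarith
  have e3 : |b - b'| = |((ε : ℤ) : ℝ) * (b - a) - ((ε : ℤ) : ℝ) * (b' - a)| := by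
    have hε : |((ε : ℤ) : ℝ)| = 1 := by rcases Int.units_eq_one_or ε with h | h <;> simp [h]
    rw [← mul_sub, abs_mul, hε, one_mul, sub_sub_sub_cancel_right]
  have h1 := ha.le_dist H hℓ hb (by linarith)
  have h2 := ha.le_dist H hℓ hb' (by linarith)
  have h3 := dist_triangle4 x (ℓ b) (ℓ b') x'
  rw [hℓ.dist_eq, Real.dist_eq, dist_comm (ℓ b') x'] at h3
  have h4 : |b - b'| ≤ |a - b| + |a - b'| - 2 * c := by
    rw [e3, ← e1, ← e2, abs_le]; constructor <;> linarith
  unfold gromovProduct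
  linarith [dist_nonneg (x := p) (y := ℓ a)]

variable {G : Type*} [Group G] [MulAction G X] [IsIsometricSMul G X] {f : G} {γ : ℝ → X}

/-- A geodesic from `p` to `x` does not follow any translate of `γ` for longer than `κ`. -/
def AvoidsAxes (G : Type*) [Group G] [MulAction G X] (γ : ℝ → X) (κ : ℝ) (p x : X) : Prop :=
  ∀ (h : G) (s t : ℝ), IsNearest (fun u => h • γ u) p s → IsNearest (fun u => h • γ u) x t →
    |s - t| ≤ κ

/-- It is enough to avoid one translate of the axis in each coset of the elementary closure, up to a
change of the constant. -/
theorem avoidsAxes_of_cosetLine (H : FourPoint X δ) (hγ : IsUnitalAxis f γ) {p x : X} {κ : ℝ}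
    (h : ∀ Y : G ⧸ elementaryClosure f,
      |nearestParam (cosetLine f γ Y) p - nearestParam (cosetLine f γ Y) x| ≤ κ) :
    AvoidsAxes G γ (κ + 34 * δ) p x := by
  intro g s t hs ht
  set Y : G ⧸ elementaryClosure f := (g : G ⧸ elementaryClosure f) with hY
  have hi := isometry_cosetLine (f := f) hγ.1 Y
  have hi' := isometry_smul_line hγ.1 g
  have hE : g⁻¹ * Y.out ∈ elementaryClosure f := QuotientGroup.eq.1 (QuotientGroup.out_eq' _).symm
  have h₁ : ∀ t, ∃ s, dist (g • γ t) (cosetLine f γ Y s) ≤ 5 * δ := by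
    intro t
    have hE' : Y.out⁻¹ * g ∈ elementaryClosure f := by simpa using inv_mem hE
    obtain ⟨s, hs⟩ := exists_isNearest hγ.1 ((Y.out⁻¹ * g) • γ t)
    refine ⟨s, ?_⟩
    have := hs.dist_le_of_mem_elementaryClosure H hγ hE'
    rwa [mul_smul, ← dist_smul Y.out, smul_inv_smul] at this
  have h₂ : ∀ t, ∃ s, dist (cosetLine f γ Y t) (g • γ s) ≤ 5 * δ := by
    intro t
    obtain ⟨s, hs⟩ := exists_isNearest hγ.1 ((g⁻¹ * Y.out) • γ t)
    refine ⟨s, ?_⟩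
    have := hs.dist_le_of_mem_elementaryClosure H hγ hE
    rwa [mul_smul, ← dist_smul g, smul_inv_smul] at this
  have a1 := hs.dist_le_of_parallel H hi' h₁ h₂ (isNearest_nearestParam hi p)
  have a2 := ht.dist_le_of_parallel H hi' h₁ h₂ (isNearest_nearestParam hi x)
  have a3 := h Y
  have a4 := dist_triangle4 (g • γ s) (cosetLine f γ Y (nearestParam (cosetLine f γ Y) p))
    (cosetLine f γ Y (nearestParam (cosetLine f γ Y) x)) (g • γ t)
  rw [dist_comm (cosetLine f γ Y (nearestParam (cosetLine f γ Y) x)), hi.dist_eq, Real.dist_eq,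
    dist_smul, hγ.1.dist_eq, Real.dist_eq] at a4
  linarith

/-- Along a path of orbit points that passes `p` on its way towards `y` there is, close to `p` in
the direction of `y`, an orbit point whose geodesic from `p` avoids all axes. Otherwise consecutive
orbit points near `p` would share a deep axis, hence the root of the tree of this axis, and so all
these points would lie on the same side of `p`. -/
theorem exists_mem_support_avoidsAxes (H : FourPoint X δ) (hγ : IsUnitalAxis f γ)
    (hf : IsWPD f (γ 0)) {S : Set G} (hS : S.Finite) :
    ∃ C κ : ℝ, 0 < C ∧ 0 ≤ κ ∧ ∀ y p : X, dist (γ 0) p + dist p y = dist (γ 0) y →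
      ∀ (a c : G) (w : (SimpleGraph.mulCayley S).Walk a c),
        gromovProduct (γ 0) (a • γ 0) y ≤ dist (γ 0) p - C →
        dist (γ 0) p + C ≤ gromovProduct (γ 0) (c • γ 0) y →
        ∃ b ∈ w.support, |gromovProduct (γ 0) (b • γ 0) y - dist (γ 0) p| < C ∧
          AvoidsAxes G γ κ p (b • γ 0) := by
  have hδ := H.nonneg (γ 0)
  obtain ⟨θ, hover⟩ := exists_overlap_bound H hγ hf
  obtain ⟨D, hD⟩ := (hS.image fun s => dist (γ 0) (s • γ 0)).bddAbove
  have hD' : ∀ s ∈ S, dist (γ 0) (s • γ 0) ≤ max D 0 := fun s hs =>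
    (hD ⟨s, hs, rfl⟩).trans (le_max_left _ _)
  have hstep : ∀ {a b : G}, (SimpleGraph.mulCayley S).Adj a b →
      dist (a • γ 0) (b • γ 0) ≤ max D 0 := by
    intro a b hab
    obtain ⟨-, s, hs, rfl | rfl⟩ := (SimpleGraph.mulCayley_adj' S a b).1 hab
    · rw [mul_smul, dist_smul]; exact hD' s hs
    · rw [mul_smul, dist_smul, dist_comm]; exact hD' s hs
  set D₀ := max D 0
  have hD₀ : 0 ≤ D₀ := le_max_right _ _
  set Θ := 10 * δ + max θ 0 with hΘ
  have hΘ0 : 10 * δ ≤ Θ := by linarith [le_max_right θ 0]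
  set K := 3 * Θ + 1 with hK
  set κ := K + Θ + D₀ + 5 * δ with hκ
  refine ⟨δ + 1 + D₀, κ + 34 * δ, by positivity, by positivity, fun y p hp a c w ha hc => ?_⟩
  set P := axisFamily H hγ (le_max_right θ 0)
    (fun h hh s t α β h1 h2 => (hover h hh s t α β h1 h2).trans (le_max_left _ _)) p with hP
  set v : G → ℝ := fun g => gromovProduct (γ 0) (g • γ 0) y with hv
  -- the two sides of the barrier
  set U : Set G := {g | (∃ R g', P.IsRoot K (g • γ 0) R ∧ P.IsRoot K (g' • γ 0) R ∧
    dist (γ 0) p + (δ + 1) ≤ v g') ∨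
    (∀ R, ¬ P.IsRoot K (g • γ 0) R) ∧ dist (γ 0) p ≤ v g} with hU
  have hhigh : ∀ g, dist (γ 0) p + (δ + 1) ≤ v g → g ∈ U := by
    intro g hg
    by_cases h : ∃ R, P.IsRoot K (g • γ 0) R
    · obtain ⟨R, hR⟩ := h
      exact Or.inl ⟨R, g, hR, hR, hg⟩
    · exact Or.inr ⟨not_exists.1 h, by linarith⟩
  have hlow : ∀ g, v g ≤ dist (γ 0) p - (δ + 1) → g ∉ U := by
    rintro g hg (⟨R, g', hR, hR', hg'⟩ | ⟨-, h⟩)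
    · have hi := isometry_cosetLine (f := f) hγ.1 R.1
      have h1 := le_gromovProduct_of_signedPart H hi R.2 (isNearest_nearestParam hi p)
        (isNearest_nearestParam hi _) (isNearest_nearestParam hi _) (c := K - Θ) (by linarith)
        (hR.le_depth le_rfl) (hR'.le_depth le_rfl)
      have h2 := gromovProduct_le_of_le_of_le H (lt_add_one δ) hp hg hg'
      linarith
    · linarith
  obtain ⟨d, hd, hd1, hd2⟩ := w.exists_boundary_dart Uᶜ (hlow a (by linarith))
    (fun h => h (hhigh c (by linarith)))
  rw [Set.mem_compl_iff] at hd1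
  rw [Set.notMem_compl_iff] at hd2
  have hdist := hstep d.adj
  refine ⟨d.fst, w.dart_fst_mem_support_of_mem_darts hd, ?_, ?_⟩
  · have h1 : v d.fst < dist (γ 0) p + (δ + 1) := lt_of_not_ge fun h => hd1 (hhigh _ h)
    have h2 : dist (γ 0) p - (δ + 1) < v d.snd := lt_of_not_ge fun h => hlow _ h hd2
    have h3 := (abs_gromovProduct_sub_le (γ 0) (d.fst • γ 0) (d.snd • γ 0) y).trans hdist
    have h4 := (abs_le.1 h3).1
    rw [abs_lt]
    constructor <;> simp only [hv] at h1 h2 <;> linarith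
  · refine avoidsAxes_of_cosetLine H hγ fun Y => ?_
    by_contra! hlong
    -- an axis followed for longer than `κ` is shared by the next orbit point
    have hi := isometry_cosetLine (f := f) hγ.1 Y
    obtain ⟨ε, hε⟩ : ∃ ε : ℤˣ, κ < P.depth (Y, ε) (d.fst • γ 0) := by
      rcases lt_abs.1 hlong with h | h
      · exact ⟨-1, lt_max_of_lt_right (by simpa using h)⟩
      · exact ⟨1, lt_max_of_lt_right (by simpa using h)⟩
    have hε' : K + Θ ≤ P.depth (Y, ε) (d.snd • γ 0) := by
      have h1 := abs_signedPart_sub_le ε (nearestParam (cosetLine f γ Y) (d.fst • γ 0))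
        (nearestParam (cosetLine f γ Y) (d.snd • γ 0)) (nearestParam (cosetLine f γ Y) p)
      have h2 := (isNearest_nearestParam hi (d.fst • γ 0)).abs_sub_le_dist H hi
        (isNearest_nearestParam hi (d.snd • γ 0))
      have h3 : P.depth (Y, ε) (d.fst • γ 0) - P.depth (Y, ε) (d.snd • γ 0) ≤ _ :=
        (le_abs_self _).trans h1
      linarith
    have hiff : ∀ R, P.IsRoot K (d.fst • γ 0) R ↔ P.IsRoot K (d.snd • γ 0) R := fun R =>
      (ProjectionFamily.isRoot_iff_isRootOfAxis le_rfl (Z := (Y, ε)) (by linarith)).trans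
        (ProjectionFamily.isRoot_iff_isRootOfAxis le_rfl hε').symm
    obtain ⟨W, hW⟩ := ProjectionFamily.exists_isParent le_rfl
      (show K ≤ P.depth (Y, ε) (d.fst • γ 0) by linarith)
    obtain ⟨R, hR⟩ := ProjectionFamily.exists_isRoot le_rfl hW
    rcases hd2 with ⟨R', g', h1, h2, h3⟩ | ⟨h1, -⟩
    · exact hd1 (Or.inl ⟨R', g', (hiff R').2 h1, h2, h3⟩)
    · exact h1 R ((hiff R).1 hR)

end Barrier

/-! ### Independent directions -/

section Directions

variable {X : Type*} [MetricSpace X] {δ : ℝ} {ℓ : ℝ → X}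

/-- A geodesic leaves the direction of a line `ℓ` at the latest where it projects to `ℓ`. -/
theorem gromovProduct_line_le (H : FourPoint X δ) (hℓ : Isometry ℓ) (o : X) {x : X} {b : ℝ}
    (hb : IsNearest ℓ x b) (s : ℝ) : gromovProduct o x (ℓ s) ≤ dist o (ℓ b) + δ := by
  have h1 := hb.add_abs_le H hℓ s
  have h2 := dist_triangle o (ℓ b) (ℓ s)
  rw [hℓ.dist_eq, Real.dist_eq, abs_sub_comm] at h2
  have h3 := dist_triangle_right o x (ℓ b)
  unfold gromovProduct
  linarith

/-- Conversely, a point not in the direction of a line starting near `o` projects near `o`. -/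
theorem IsNearest.abs_le_of_gromovProduct_le (H : FourPoint X δ) (hℓ : Isometry ℓ) {o x : X}
    {C U s : ℝ} (hU : dist o (ℓ 0) ≤ U) (hC : ∀ t, gromovProduct o x (ℓ t) ≤ C)
    (hs : IsNearest ℓ x s) : |s| ≤ C + U + δ := by
  have h1 := hs.add_abs_le H hℓ 0
  rw [zero_sub, abs_neg] at h1
  have h2 := hC s
  have h3 := dist_triangle_left x (ℓ 0) o
  have h4 := dist_triangle_left (ℓ s) (ℓ 0) o
  rw [hℓ.dist_eq, Real.dist_eq, sub_zero] at h4
  unfold gromovProduct at h2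
  linarith

/-- The projection to a line of a geodesic whose endpoints have nearby projections is small. -/
theorem IsNearest.abs_sub_le_of_between (H : FourPoint X δ) (hℓ : Isometry ℓ) {o p y : X}
    {a b c : ℝ} (hp : dist o p + dist p y = dist o y) (ha : IsNearest ℓ o a)
    (hb : IsNearest ℓ p b) (hc : IsNearest ℓ y c) : |b - a| ≤ 10 * δ + |a - c| := by
  have hδ := H.nonneg o
  by_contra! h
  have h0 := abs_nonneg (a - c)
  have h1 : |b - a| ≤ |b - c| + |a - c| := by
    rw [abs_sub_comm a c]; exact abs_sub_le _ _ _
  have h2 := hb.le_dist H hℓ ha (by linarith)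
  have h3 := hb.le_dist H hℓ hc (by linarith)
  have h4 := dist_triangle4 o (ℓ a) (ℓ c) y
  rw [hℓ.dist_eq, Real.dist_eq, dist_comm (ℓ c) y] at h4
  rw [dist_comm p o] at h2
  linarith [dist_nonneg (x := p) (y := ℓ b), abs_nonneg (b - c)]

/-- If the directions of the lines `ℓ i` are independent, then a given point is in the direction of
at most one of them; so among four of them there is one which avoids three given points. -/
theorem exists_forall_gromovProduct_le (H : FourPoint X δ) {o : X} {ℓ : Fin 4 → ℝ → X} {C : ℝ}
    (hC : ∀ i j, i ≠ j → ∀ s t, gromovProduct o (ℓ i s) (ℓ j t) ≤ C) (x : Fin 3 → X) :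
    ∃ i, ∀ k s, gromovProduct o (x k) (ℓ i s) ≤ C + δ := by
  by_contra! h
  choose k s hs using h
  obtain ⟨i, j, hij, hk⟩ := Fintype.exists_ne_map_eq_of_card_lt k (by simp)
  have h1 := hs i
  have h2 := hs j
  rw [← hk] at h2
  have h3 := hC i j hij (s i) (s j)
  have hδ := H.nonneg o
  unfold gromovProduct at h1 h2 h3
  rcases H.le_or (ℓ i (s i)) (ℓ j (s j)) (x (k i)) o with h | h <;>
    linarith [dist_comm o (x (k i)), dist_comm o (ℓ i (s i)), dist_comm o (ℓ j (s j)),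
      dist_comm (x (k i)) (ℓ i (s i)), dist_comm (x (k i)) (ℓ j (s j))]

variable {G : Type*} [Group G] [MulAction G X] [IsIsometricSMul G X] {f : G} {γ : ℝ → X}

/-- Translates of the axis by elements of distinct cosets of the elementary closure of `f` have
bounded projections to each other, so they are independent directions. -/
theorem exists_independent_directions (H : FourPoint X δ) (hγ : IsUnitalAxis f γ)
    (hf : IsWPD f (γ 0)) (hG : ¬ IsVirtuallyCyclic G) :
    ∃ (u : Fin 4 → G) (C : ℝ), 0 ≤ C ∧
      ∀ i j, i ≠ j → ∀ s t, gromovProduct (γ 0) (u i • γ s) (u j • γ t) ≤ C := by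
  have := infinite_quotient_elementaryClosure H hγ hf hG
  obtain ⟨θ, hover⟩ := exists_overlap_bound H hγ hf
  set Y := Infinite.natEmbedding (G ⧸ elementaryClosure f)
  set u : Fin 4 → G := fun i => (Y i).out with hu
  have hnot : ∀ i j : Fin 4, i ≠ j → (u j)⁻¹ * u i ∉ elementaryClosure f := by
    intro i j hij
    rw [← QuotientGroup.eq, QuotientGroup.out_eq', QuotientGroup.out_eq']
    exact fun h => hij (Fin.ext (Y.injective h)).symm
  have hb : ∀ i j : Fin 4, ∃ C : ℝ, i ≠ j →
      ∀ s t, gromovProduct (γ 0) (u i • γ s) (u j • γ t) ≤ C := by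
    intro i j
    have hi := isometry_smul_line hγ.1 (u j)
    obtain ⟨b₀, hb₀⟩ := exists_isNearest hi (u i • γ 0)
    refine ⟨dist (γ 0) (u j • γ b₀) + θ + δ, fun hij s t => ?_⟩
    obtain ⟨b, hb⟩ := exists_isNearest hi (u i • γ s)
    have key : ∀ {s b}, IsNearest (fun t => u j • γ t) (u i • γ s) b →
        IsNearest γ (((u j)⁻¹ * u i) • γ s) b := fun {s b} h => by
      rwa [← isNearest_smul_iff (h := u j), mul_smul, smul_inv_smul]
    have h1 := hover _ (hnot i j hij) _ _ _ _ (key hb₀) (key hb)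
    have h2 := gromovProduct_line_le H hi (γ 0) hb t
    have h3 := dist_triangle (γ 0) (u j • γ b₀) (u j • γ b)
    rw [dist_smul, hγ.1.dist_eq, Real.dist_eq] at h3
    linarith
  choose C hC using hb
  obtain ⟨M, hM⟩ := (Set.finite_range fun ij : Fin 4 × Fin 4 => C ij.1 ij.2).bddAbove
  exact ⟨u, max M 0, le_max_right _ _, fun i j hij s t => (hC i j hij s t).trans
    ((hM ⟨(i, j), rfl⟩).trans (le_max_left _ _))⟩

end Directions

/-! ### Unique decoding -/

section Stems

variable {G X : Type*} [Group G] [MetricSpace X] [MulAction G X] {δ : ℝ} {f : G} {γ : ℝ → X}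

/-- The line `a • γ` leaves from its point `a • γ 0` in a direction different from those of the
base point `γ 0` and of the points `y` and `e`: these project to the line near `a • γ 0`.
Moreover, if the base point and `y` project to a translate `h • γ` near `h • γ 0`, then so does `a
• γ 0`. The letters of the code are the elements `a * f ^ N * v` with `a` a stem, for suitable `N`
and `v`. -/
structure IsStem (γ : ℝ → X) (κ₁ κ₂ : ℝ) (y e : X) (a : G) : Prop where
  base : ∀ s, IsNearest (fun t => a • γ t) (γ 0) s → |s| ≤ κ₁
  target : ∀ s, IsNearest (fun t => a • γ t) y s → |s| ≤ κ₁
  back : ∀ s, IsNearest (fun t => a • γ t) e s → |s| ≤ κ₁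
  avoids : ∀ h : G, (∀ s, IsNearest (fun t => h • γ t) (γ 0) s → |s| ≤ κ₁) →
    (∀ s, IsNearest (fun t => h • γ t) y s → |s| ≤ κ₁) →
    ∀ s, IsNearest (fun t => h • γ t) (a • γ 0) s → |s| ≤ κ₂

variable [IsIsometricSMul G X]

/-- Multiplying an element whose orbit point avoids the axes by a suitable one of four independent
directions gives a stem. -/
theorem exists_isStem (H : FourPoint X δ) (hγ : Isometry γ) {u : Fin 4 → G} {C U κ : ℝ}
    (hC : ∀ i j, i ≠ j → ∀ s t, gromovProduct (γ 0) (u i • γ s) (u j • γ t) ≤ C)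
    (hU : ∀ i, dist (γ 0) (u i • γ 0) ≤ U) (y e : X) {g : G} {p : X}
    (hp : dist (γ 0) p + dist p y = dist (γ 0) y) (hg : AvoidsAxes G γ κ p (g • γ 0)) :
    ∃ i, IsStem γ (C + U + 5 * δ) (3 * (C + U + 5 * δ) + 15 * δ + κ + U) y e (g * u i) := by
  have hδ := H.nonneg (γ 0)
  obtain ⟨i, hi⟩ := exists_forall_gromovProduct_le H (ℓ := fun i t => u i • γ t) hC
    ![g⁻¹ • γ 0, g⁻¹ • y, g⁻¹ • e]
  have hiso := isometry_smul_line hγ (u i)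
  have near : ∀ x, (∀ s, gromovProduct (γ 0) (g⁻¹ • x) (u i • γ s) ≤ C + δ) →
      ∀ s, IsNearest (fun t => (g * u i) • γ t) x s → |s| ≤ C + U + 5 * δ := by
    intro x hx s hs
    have : IsNearest (fun t => u i • γ t) (g⁻¹ • x) s := by
      rw [← isNearest_smul_iff (h := g), smul_inv_smul]
      simpa only [mul_smul] using hs
    have := this.abs_le_of_gromovProduct_le H hiso (hU i) hx
    linarith
  refine ⟨i, near _ (hi 0), near _ (hi 1), near _ (hi 2), fun h h0 hy s hs => ?_⟩
  have hℓ := isometry_smul_line hγ h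
  obtain ⟨a, ha⟩ := exists_isNearest hℓ (γ 0)
  obtain ⟨b, hb⟩ := exists_isNearest hℓ p
  obtain ⟨c, hc⟩ := exists_isNearest hℓ y
  obtain ⟨d, hd⟩ := exists_isNearest hℓ (g • γ 0)
  have h1 := ha.abs_sub_le_of_between H hℓ hp hb hc
  have h2 := hg h b d hb hd
  have h3 := hd.abs_sub_le_dist H hℓ hs
  rw [mul_smul, dist_smul] at h3
  have h4 := hU i
  have h5 := abs_le.1 (h0 a ha)
  have h6 := abs_le.1 (hy c hc)
  have h7 : |a - c| ≤ 2 * (C + U + 5 * δ) := by rw [abs_le]; constructor <;> linarith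
  have h8 := abs_le.1 (h1.trans (add_le_add_right h7 _))
  have h9 := abs_le.1 h2
  have h10 := abs_le.1 (h3.trans (add_le_add_left h4 _))
  rw [abs_le]; constructor <;> linarith

/-- If a broken geodesic through `w, x, x', z` hardly turns back at `x` and at `x'`, and its middle
segment is long, then a geodesic from `w` to `z` nearly passes through `x`. -/
theorem FourPoint.nearly_between_of_long (H : FourPoint X δ) {w x x' z : X} {c c' : ℝ}
    (h : dist w x + dist x x' ≤ dist w x' + c) (h' : dist x x' + dist x' z ≤ dist x z + c')
    (hlong : c + c' + δ < 2 * dist x x') : dist w x + dist x z ≤ dist w z + c + δ := by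
  rcases H.le_or w x' x z with h1 | h1 <;> linarith [dist_comm x x']

theorem add_le_dist_line (H : FourPoint X δ) {ℓ : ℝ → X} (hℓ : Isometry ℓ) {w : X} {κ : ℝ}
    (hw : ∀ s, IsNearest ℓ w s → |s| ≤ κ) (t : ℝ) :
    dist w (ℓ 0) + t ≤ dist w (ℓ t) + (2 * κ + 2 * δ) := by
  obtain ⟨s, hs⟩ := exists_isNearest hℓ w
  have h1 := hs.add_abs_le H hℓ t
  have h2 := hw s hs
  have h3 := dist_triangle w (ℓ s) (ℓ 0)
  rw [hℓ.dist_eq, Real.dist_eq, sub_zero] at h3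
  linarith [le_abs_self (t - s), le_abs_self s]

/-- The element `v` ends the letters `a * f ^ N * v`: the line `v⁻¹ • γ` leaves from the base
point in a direction different from that of `y`, and the length `N` of the stems is large. Seen
from its end, a letter points in the direction of `v⁻¹ • γ (-N)`, which is the point `e` to be
used in `IsStem`. -/
structure IsMarker (γ : ℝ → X) (δ κ₁ κ₂ U : ℝ) (y : X) (N : ℕ) (v : G) : Prop where
  base : ∀ s, IsNearest (fun t => v⁻¹ • γ t) (γ 0) s → |s| ≤ κ₁
  target : ∀ s, IsNearest (fun t => v⁻¹ • γ t) y s → |s| ≤ κ₁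
  dist_le : dist (γ 0) (v⁻¹ • γ 0) ≤ U
  κ₂_nonneg : 0 ≤ κ₂
  large : 8 * κ₁ + 4 * κ₂ + 6 * U + 13 * δ < N

/-- Twice the Gromov product of the direction of a marker and a product of letters is at most
`productBound δ κ₁ κ₂ U`. -/
def productBound (δ κ₁ κ₂ U : ℝ) : ℝ := 2 * (U + κ₁ + κ₂) + 5 * δ

variable {κ₁ κ₂ U : ℝ} {y : X} {N : ℕ} {v : G}

/-- A geodesic from the start of the first stem to a product of letters nearly passes through the
end of this stem. -/
theorem IsMarker.end_nearly_between (hγ : IsUnitalAxis f γ) (hv : IsMarker γ δ κ₁ κ₂ U y N v)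
    (a : G) {z : X}
    (hz : 2 * gromovProduct (γ 0) (v⁻¹ • γ (-N)) z ≤ productBound δ κ₁ κ₂ U) :
    dist (a • γ 0) (a • γ N) + dist (a • γ N) ((a * f ^ N * v) • z) ≤
      dist (a • γ 0) ((a * f ^ N * v) • z) + (productBound δ κ₁ κ₂ U + 2 * U) := by
  have e0 : f ^ N • γ (-N) = γ 0 := by rw [hγ.pow_smul, neg_add_cancel]
  have e1 : a • γ 0 = (a * f ^ N * v) • v⁻¹ • γ (-N) := by
    rw [mul_smul, smul_inv_smul, mul_smul, e0]
  have e2 : a • γ N = (a * f ^ N * v) • v⁻¹ • γ 0 := by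
    rw [mul_smul, smul_inv_smul, mul_smul, hγ.pow_smul, zero_add]
  rw [e1, e2, dist_smul (a * f ^ N * v), dist_smul (a * f ^ N * v), dist_smul (a * f ^ N * v)]
  have h1 := hv.dist_le
  have h2 := dist_triangle_left (v⁻¹ • γ (-N)) (v⁻¹ • γ 0) (γ 0)
  have h3 := dist_triangle_left (v⁻¹ • γ 0) z (γ 0)
  unfold gromovProduct at hz
  linarith

theorem dist_smul_line_length (hγ : IsUnitalAxis f γ) (a : G) (N : ℕ) :
    dist (a • γ 0) (a • γ N) = N := by
  rw [dist_smul, hγ.1.dist_eq, Real.dist_eq, zero_sub, abs_neg, Nat.abs_cast]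

/-- A geodesic from `w` to a product of letters nearly passes through the start of the first
stem. -/
theorem IsMarker.start_nearly_between (H : FourPoint X δ) (hγ : IsUnitalAxis f γ)
    (hv : IsMarker γ δ κ₁ κ₂ U y N v) {a : G} {w z : X}
    (hw : ∀ s, IsNearest (fun t => a • γ t) w s → |s| ≤ κ₁)
    (hz : 2 * gromovProduct (γ 0) (v⁻¹ • γ (-N)) z ≤ productBound δ κ₁ κ₂ U) :
    dist w (a • γ 0) + dist (a • γ 0) ((a * f ^ N * v) • z) ≤
      dist w ((a * f ^ N * v) • z) + (2 * κ₁ + 2 * δ) + δ := by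
  have hN := dist_smul_line_length hγ a N
  have h1 := add_le_dist_line H (isometry_smul_line hγ.1 a) hw N
  have h2 := hv.end_nearly_between hγ a hz
  have h3 := hv.large
  have hδ := H.nonneg w
  have hU := dist_nonneg.trans hv.dist_le
  obtain ⟨s, hs⟩ := exists_isNearest (isometry_smul_line hγ.1 a) w
  have hκ₁ : 0 ≤ κ₁ := (abs_nonneg s).trans (hw s hs)
  refine H.nearly_between_of_long (by rw [hN]; exact h1) h2 ?_
  rw [hN]
  unfold productBound
  linarith [hv.κ₂_nonneg]

/-- The whole stem of the first letter nearly lies on a geodesic from the base point to a product of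
letters. -/
theorem IsMarker.stem_nearly_between (H : FourPoint X δ) (hγ : IsUnitalAxis f γ)
    (hv : IsMarker γ δ κ₁ κ₂ U y N v) {a : G} {w z : X}
    (hw : ∀ s, IsNearest (fun t => a • γ t) w s → |s| ≤ κ₁)
    (hz : 2 * gromovProduct (γ 0) (v⁻¹ • γ (-N)) z ≤ productBound δ κ₁ κ₂ U) {t : ℝ}
    (h0 : 0 ≤ t) (ht : t ≤ N) :
    dist w (a • γ t) + dist (a • γ t) ((a * f ^ N * v) • z) ≤
      dist w ((a * f ^ N * v) • z) +
        (2 * κ₁ + 2 * δ + δ + (productBound δ κ₁ κ₂ U + 2 * U)) := by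
  have h1 := hv.start_nearly_between H hγ hw hz
  have h2 := hv.end_nearly_between hγ a hz
  have h3 := dist_triangle w (a • γ 0) (a • γ t)
  have h4 := dist_triangle (a • γ t) (a • γ N) ((a * f ^ N * v) • z)
  have e1 : dist (a • γ 0) (a • γ t) = t := by
    rw [dist_smul, hγ.1.dist_eq, Real.dist_eq, zero_sub, abs_neg, abs_of_nonneg h0]
  have e2 : dist (a • γ t) (a • γ N) = N - t := by
    rw [dist_smul, hγ.1.dist_eq, Real.dist_eq, abs_of_nonpos] <;> linarith
  rw [dist_smul_line_length hγ] at h2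
  linarith

/-- No product of letters points in the direction of the marker. -/
theorem IsMarker.gromovProduct_prod_le (H : FourPoint X δ) (hγ : IsUnitalAxis f γ)
    (hv : IsMarker γ δ κ₁ κ₂ U y N v) (hκ₁ : 0 ≤ κ₁) (l : List G)
    (hl : ∀ b ∈ l, ∃ a, IsStem γ κ₁ κ₂ y (v⁻¹ • γ (-N)) a ∧ b = a * f ^ N * v) :
    2 * gromovProduct (γ 0) (v⁻¹ • γ (-N)) (l.prod • γ 0) ≤ productBound δ κ₁ κ₂ U := by
  have hδ := H.nonneg (γ 0)
  have hU := dist_nonneg.trans hv.dist_le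
  induction l with
  | nil =>
    simp only [List.prod_nil, one_smul, gromovProduct, dist_self, productBound]
    rw [dist_comm (γ 0)]
    linarith [hv.κ₂_nonneg]
  | cons b l ih =>
    obtain ⟨a, ha, rfl⟩ := hl b List.mem_cons_self
    have hz := ih fun c hc => hl c (List.mem_cons_of_mem _ hc)
    rw [List.prod_cons, mul_smul]
    have h1 := hv.start_nearly_between H hγ ha.back hz
    have h2 := dist_triangle (γ 0) (a • γ 0) ((a * f ^ N * v) • l.prod • γ 0)
    have hi := isometry_smul_line hγ.1 v⁻¹
    obtain ⟨s, hs⟩ := exists_isNearest hi (a • γ 0)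
    have h3 := ha.avoids v⁻¹ hv.base hv.target s hs
    have h4 := gromovProduct_line_le H hi (γ 0) hs (-N)
    have h5 := dist_triangle (γ 0) (v⁻¹ • γ 0) (v⁻¹ • γ s)
    have h6 := hv.dist_le
    rw [dist_smul, hγ.1.dist_eq, Real.dist_eq, zero_sub, abs_neg] at h5
    unfold gromovProduct at h4 ⊢
    unfold productBound
    linarith [dist_comm (v⁻¹ • γ (-N)) (a • γ 0)]

/-- If two products of letters coincide, then the first stems start at about the same point. For
both stems lie on a geodesic to the product; if the second one started after the middle of the
first, then a geodesic from the base point to the start of the second stem would follow the first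
half of the first one, which is excluded by `IsStem.avoids`. -/
theorem IsMarker.exists_eq_mul (H : FourPoint X δ) (hγ : IsUnitalAxis f γ)
    (hv : IsMarker γ δ κ₁ κ₂ U y N v) {a a' : G} {z z' : X}
    (ha : IsStem γ κ₁ κ₂ y (v⁻¹ • γ (-N)) a) (ha' : IsStem γ κ₁ κ₂ y (v⁻¹ • γ (-N)) a')
    (hz : 2 * gromovProduct (γ 0) (v⁻¹ • γ (-N)) z ≤ productBound δ κ₁ κ₂ U)
    (hz' : 2 * gromovProduct (γ 0) (v⁻¹ • γ (-N)) z' ≤ productBound δ κ₁ κ₂ U)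
    (heq : (a * f ^ N * v) • z = (a' * f ^ N * v) • z')
    (hle : dist (γ 0) (a • γ 0) ≤ dist (γ 0) (a' • γ 0)) {L : ℕ} (hL : 2 * L ≤ N) :
    ∃ n ≤ N, ∃ q : G, a' = a * f ^ n * q ∧
      dist (γ 0) (q • γ 0) ≤ 6 * κ₁ + 2 * κ₂ + 4 * U + 13 * δ + 1 ∧
      dist (f ^ L • γ 0) (q • f ^ L • γ 0) ≤ 6 * κ₁ + 2 * κ₂ + 4 * U + 13 * δ + 1 := by
  have hδ := H.nonneg (γ 0)
  have hU := dist_nonneg.trans hv.dist_le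
  have hlarge := hv.large
  have hL' : 2 * (L : ℝ) ≤ N := by exact_mod_cast hL
  have hi := isometry_smul_line hγ.1 a
  have hi' := isometry_smul_line hγ.1 a'
  have hN : (0 : ℝ) ≤ N := Nat.cast_nonneg _
  have upper : ∀ (g : G) {t : ℝ}, 0 ≤ t →
      dist (γ 0) (g • γ t) ≤ dist (γ 0) (g • γ 0) + t := by
    intro g t ht
    have := dist_triangle (γ 0) (g • γ 0) (g • γ t)
    rwa [dist_smul g, hγ.1.dist_eq, Real.dist_eq, zero_sub, abs_neg, abs_of_nonneg ht] at this
  have hmid : dist (γ 0) (a' • γ 0) - dist (γ 0) (a • γ 0) ≤ N / 2 := by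
    by_contra! hfar
    have h1 := hv.stem_nearly_between H hγ ha.base hz (t := N / 2) (by linarith) (by linarith)
    have h2 := hv.stem_nearly_between H hγ ha'.base hz' (t := 0) le_rfl hN
    rw [← heq] at h2
    have h3 := upper a (t := N / 2) (by linarith)
    obtain ⟨s, hs⟩ := exists_isNearest hi (γ 0)
    obtain ⟨s', hs'⟩ := exists_isNearest hi (a' • γ 0)
    have h4 := ha.base s hs
    have h5 := ha'.avoids a ha.base ha.target s' hs'
    have h6 := hs.add_abs_le H hi (N / 2)
    have h7 := hs'.add_abs_le H hi (N / 2)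
    have h8 := dist_triangle4 (γ 0) (a • γ s) (a • γ s') (a' • γ 0)
    rw [dist_smul, hγ.1.dist_eq, Real.dist_eq, dist_comm (a • γ s')] at h8
    have h9 : |s - s'| ≤ κ₁ + κ₂ := (abs_sub _ _).trans (add_le_add h4 h5)
    have h10 := le_abs_self s
    have h11 := le_abs_self s'
    have h12 := le_abs_self (N / 2 - s)
    have h13 := le_abs_self (N / 2 - s')
    have h14 := dist_comm (a' • γ 0) (a • γ (N / 2))
    have h15 := abs_nonneg s
    unfold productBound at h1 h2
    rcases H.le_or (γ 0) ((a * f ^ N * v) • z) (a • γ (N / 2)) (a' • γ 0) with h | h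
    · linarith [dist_comm ((a * f ^ N * v) • z) (a' • γ 0)]
    · linarith [dist_comm ((a * f ^ N * v) • z) (a • γ (N / 2))]
  set m := dist (γ 0) (a' • γ 0) - dist (γ 0) (a • γ 0) with hm
  have hm0 : 0 ≤ m := sub_nonneg.2 hle
  have hn1 := Nat.floor_le hm0
  have hn2 := Nat.lt_floor_add_one m
  have near : ∀ k : ℕ, 2 * k ≤ N → dist (a' • γ k) (a • γ (k + ⌊m⌋₊)) ≤
      6 * κ₁ + 2 * κ₂ + 4 * U + 13 * δ + 1 := by
    intro k hk
    have hk' : 2 * (k : ℝ) ≤ N := by exact_mod_cast hk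
    have hk0 : (0 : ℝ) ≤ k := Nat.cast_nonneg _
    have hf0 : (0 : ℝ) ≤ ⌊m⌋₊ := Nat.cast_nonneg _
    have h1 := hv.stem_nearly_between H hγ ha.base hz (t := k + ⌊m⌋₊) (by linarith) (by linarith)
    have h2 := hv.stem_nearly_between H hγ ha'.base hz' (t := k) hk0 (by linarith)
    rw [← heq] at h2
    have h3 := upper a (t := k + ⌊m⌋₊) (by linarith)
    have h4 := upper a' (t := k) hk0
    have h5 := add_le_dist_line H hi ha.base (k + ⌊m⌋₊)
    have h6 := add_le_dist_line H hi' ha'.base k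
    have h7 := H.dist_le_of_nearly_between h2 h1 (e := 2 * κ₁ + 2 * δ + 1)
      (by rw [abs_le]; constructor <;> linarith)
    rw [max_self] at h7
    unfold productBound at h7
    linarith
  have hmove : ∀ k : ℕ, dist (γ k) (((a * f ^ ⌊m⌋₊)⁻¹ * a') • γ k) =
      dist (a' • γ k) (a • γ (k + ⌊m⌋₊)) := by
    intro k
    rw [← dist_smul (a * f ^ ⌊m⌋₊), ← mul_smul, mul_inv_cancel_left, mul_smul, hγ.pow_smul,
      dist_comm]
  refine ⟨⌊m⌋₊, ?_, (a * f ^ ⌊m⌋₊)⁻¹ * a', by group, ?_, ?_⟩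
  · have : (⌊m⌋₊ : ℝ) ≤ N := by linarith
    exact_mod_cast this
  · have h1 := near 0 (by omega)
    rw [← hmove, Nat.cast_zero] at h1
    exact h1
  · rw [hγ.pow_smul, zero_add, hmove]
    exact near L hL

end Stems

/-! ### Roughly branching sets -/

section Branching

theorem wordDist_mul_right {G : Type*} [Group G] (S : Set G) (b q : G) :
    wordDist S b (b * q) = wordDist S 1 q := by
  simp [wordDist]

/-- A maximal subset of `T` without two distinct elements that differ by an element of `Φ`. -/
theorem exists_maximal_separated {G : Type*} [Group G] (T Φ : Set G) :
    ∃ B ⊆ T, (∀ b ∈ B, ∀ c ∈ B, b⁻¹ * c ∈ Φ → b = c) ∧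
      ∀ t ∈ T, ∃ b ∈ B, b = t ∨ b⁻¹ * t ∈ Φ ∨ t⁻¹ * b ∈ Φ := by
  obtain ⟨B, hB⟩ := zorn_subset {B : Set G | B ⊆ T ∧ ∀ b ∈ B, ∀ c ∈ B, b⁻¹ * c ∈ Φ → b = c} (by
    intro c hc hchain
    refine ⟨⋃₀ c, ⟨Set.sUnion_subset fun s hs => (hc hs).1, ?_⟩,
      fun s hs => Set.subset_sUnion_of_mem hs⟩
    rintro b ⟨s, hs, hbs⟩ b' ⟨s', hs', hbs'⟩ h
    rcases hchain.total hs hs' with h' | h'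
    · exact (hc hs').2 b (h' hbs) b' hbs' h
    · exact (hc hs).2 b hbs b' (h' hbs') h)
  refine ⟨B, hB.prop.1, hB.prop.2, fun t ht => ?_⟩
  by_contra! hcon
  have hmem : insert t B ∈ {B : Set G | B ⊆ T ∧ ∀ b ∈ B, ∀ c ∈ B, b⁻¹ * c ∈ Φ → b = c} := by
    refine ⟨Set.insert_subset ht hB.prop.1, ?_⟩
    rintro b (rfl | hb) c (rfl | hc) h
    · rfl
    · exact absurd h (hcon c hc).2.2
    · exact absurd h (hcon b hb).2.1
    · exact hB.prop.2 b hb c hc h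
  have ht' : t ∈ B := hB.le_of_ge hmem (Set.subset_insert t B) (Set.mem_insert t B)
  exact (hcon t ht').1 rfl

/-- Words of equal length can be decoded letter by letter if their first letters can. -/
theorem prod_ofFn_ne_of_cancel {G : Type*} [Group G] {B : Set G}
    (h : ∀ b ∈ B, ∀ c ∈ B, ∀ l l' : List G, (∀ x ∈ l, x ∈ B) → (∀ x ∈ l', x ∈ B) →
      (b :: l).prod = (c :: l').prod → b = c) {k : ℕ} {g g' : Fin k → G}
    (hg : ∀ i, g i ∈ B) (hg' : ∀ i, g' i ∈ B) (hne : g ≠ g') :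
    (List.ofFn g).prod ≠ (List.ofFn g').prod := by
  have key : ∀ l l' : List G, l.length = l'.length → (∀ x ∈ l, x ∈ B) → (∀ x ∈ l', x ∈ B) →
      l.prod = l'.prod → l = l' := by
    intro l
    induction l with
    | nil =>
      intro l' hlen _ _ _
      exact (List.length_eq_zero_iff.1 hlen.symm).symm
    | cons b l ih =>
      rintro (_ | ⟨c, l'⟩) hlen hl hl' heq
      · simp at hlen
      · simp only [List.mem_cons, forall_eq_or_imp] at hl hl'
        obtain rfl := h b hl.1 c hl'.1 l l' hl.2 hl'.2 heq
        rw [List.prod_cons, List.prod_cons] at heq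
        rw [ih l' (by simpa using hlen) hl.2 hl'.2 (mul_left_cancel heq)]
  intro heq
  refine hne (List.ofFn_injective (key _ _ (by simp) ?_ ?_ heq))
  · simpa [List.mem_ofFn] using hg
  · simpa [List.mem_ofFn] using hg'

variable {G X : Type*} [Group G] [MetricSpace X] [MulAction G X] [IsIsometricSMul G X]
  {δ : ℝ} {f : G} {γ : ℝ → X}

/-- The elements `g` such that a geodesic from some point between the base point and `y` to the
orbit point of `g` avoids all axes form a roughly branching set. Such a `g` is replaced by a letter
`g * u * f ^ N * v`, where `u` is one of four independent directions, chosen according to `g`, and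
`v` is chosen according to `y`; a separated set of letters is a code. -/
theorem exists_isRoughlyBranching (H : FourPoint X δ) (hγ : IsUnitalAxis f γ)
    (hf : IsWPD f (γ 0)) (hG : ¬ IsVirtuallyCyclic G) (S : Set G) {κ : ℝ} (hκ : 0 ≤ κ) :
    ∃ r₀ : ℝ, ∀ r, r₀ ≤ r → ∀ (y : X) (B : Set G),
      (∀ g ∈ B, ∃ p, dist (γ 0) p + dist p y = dist (γ 0) y ∧ AvoidsAxes G γ κ p (g • γ 0)) →
      IsRoughlyBranching S r B := by
  have hδ := H.nonneg (γ 0)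
  obtain ⟨u, C, hC0, hC⟩ := exists_independent_directions H hγ hf hG
  obtain ⟨U, hU⟩ : ∃ U, ∀ i, dist (γ 0) (u i • γ 0) ≤ U := by
    obtain ⟨U, hU⟩ := (Set.finite_range fun i => dist (γ 0) (u i • γ 0)).bddAbove
    exact ⟨U, fun i => hU ⟨i, rfl⟩⟩
  have hU0 : 0 ≤ U := dist_nonneg.trans (hU 0)
  set κ₁ := C + U + 5 * δ with hκ₁
  set κ₂ := 3 * κ₁ + 15 * δ + κ + U with hκ₂
  have hκ₁0 : 0 ≤ κ₁ := by positivity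
  have hκ₂0 : 0 ≤ κ₂ := by positivity
  obtain ⟨L, hL0, hL⟩ := hf (6 * κ₁ + 2 * κ₂ + 4 * U + 13 * δ + 2) (by positivity)
  set F := {g : G | dist (γ 0) (g • γ 0) < 6 * κ₁ + 2 * κ₂ + 4 * U + 13 * δ + 2 ∧
    dist (f ^ L • γ 0) (g • f ^ L • γ 0) < 6 * κ₁ + 2 * κ₂ + 4 * U + 13 * δ + 2} with hF
  obtain ⟨N, hNL, hN⟩ : ∃ N : ℕ, 2 * L ≤ N ∧ 8 * κ₁ + 4 * κ₂ + 6 * U + 13 * δ < N := by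
    obtain ⟨n, hn⟩ := exists_nat_gt (8 * κ₁ + 4 * κ₂ + 6 * U + 13 * δ)
    exact ⟨max (2 * L) n, le_max_left _ _, hn.trans_le (by exact_mod_cast le_max_right _ _)⟩
  -- the possible values of `b⁻¹ * c` when `b` and `c` are first letters of equal products
  set Φ : G → Set G := fun v =>
    (fun x : ℕ × G => (f ^ N * v)⁻¹ * (f ^ x.1 * x.2) * (f ^ N * v)) '' (Set.Iic N ×ˢ F) with hΦ
  have hΦfin : ∀ v, (Φ v).Finite := fun v => ((Set.finite_Iic N).prod hL).image _
  set Q : Set G := ⋃ ij : Fin 4 × Fin 4, (fun x => x * (u ij.1 * f ^ N * (u ij.2)⁻¹)⁻¹) ''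
    ({1} ∪ Φ (u ij.2)⁻¹ ∪ (Φ (u ij.2)⁻¹)⁻¹) with hQ
  have hQfin : Q.Finite := Set.finite_iUnion fun ij =>
    ((((Set.finite_singleton 1).union (hΦfin _)).union (hΦfin _).inv).image _)
  obtain ⟨r₀, hr₀⟩ := (hQfin.image fun q => (wordDist S 1 q : ℝ)).bddAbove
  refine ⟨r₀, fun r hr y B hB => ?_⟩
  -- the marker leaves in a direction different from that of `y`
  obtain ⟨j, hj⟩ := exists_forall_gromovProduct_le H (ℓ := fun i t => u i • γ t) hC
    ![y, y, y]
  have hmark : IsMarker γ δ κ₁ κ₂ U y N (u j)⁻¹ := by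
    have hi := isometry_smul_line hγ.1 (u j)
    refine ⟨?_, ?_, ?_, hκ₂0, hN⟩ <;> rw [inv_inv]
    · intro s hs
      have h1 := hs.add_abs_le H hi 0
      have h2 := hs.abs_sub_le_dist H hi (y := u j • γ 0) (t := 0) fun v => by
        simp only [dist_self]; exact dist_nonneg
      rw [sub_zero] at h2
      linarith [hU j]
    · intro s hs
      have := hs.abs_le_of_gromovProduct_le H hi (hU j) (hj 0)
      linarith
    · exact hU j
  set v : G := (u j)⁻¹ with hv
  have hstem : ∀ g ∈ B, ∃ i, IsStem γ κ₁ κ₂ y (v⁻¹ • γ (-N)) (g * u i) := by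
    intro g hg
    obtain ⟨p, hp, hgp⟩ := hB g hg
    exact exists_isStem H hγ.1 hC hU y _ hp hgp
  set T : Set G := {b | ∃ a, IsStem γ κ₁ κ₂ y (v⁻¹ • γ (-N)) a ∧ b = a * f ^ N * v} with hT
  obtain ⟨B', hB'T, hsep, hmax⟩ := exists_maximal_separated T (Φ v)
  refine ⟨B', fun g hg => ?_, fun k _ g g' hg hg' hne =>
    prod_ofFn_ne_of_cancel (fun b hb c hc l l' hl hl' heq => ?_) hg hg' hne⟩
  · obtain ⟨i, hi⟩ := hstem g hg
    obtain ⟨b, hb, hbg⟩ := hmax (g * u i * f ^ N * v) ⟨_, hi, rfl⟩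
    refine ⟨b, hb, ?_⟩
    have hq : b⁻¹ * g ∈ Q := by
      refine Set.mem_iUnion.2 ⟨(i, j), b⁻¹ * (g * u i * f ^ N * v), ?_, ?_⟩
      · rcases hbg with h | h | h
        · exact Or.inl (Or.inl (by rw [← h]; simp))
        · exact Or.inl (Or.inr h)
        · refine Or.inr ?_
          rw [Set.mem_inv]
          convert h using 1
          group
      · simp only [hv]; group
    have h1 := wordDist_mul_right S b (b⁻¹ * g)
    rw [mul_inv_cancel_left] at h1
    rw [h1]
    exact (hr₀ ⟨_, hq, rfl⟩).trans hr
  · have hz := hmark.gromovProduct_prod_le H hγ hκ₁0 l fun x hx => hB'T (hl x hx)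
    have hz' := hmark.gromovProduct_prod_le H hγ hκ₁0 l' fun x hx => hB'T (hl' x hx)
    obtain ⟨a, ha, hba⟩ := hB'T hb
    obtain ⟨a', ha', hca⟩ := hB'T hc
    rw [List.prod_cons, List.prod_cons] at heq
    have heq' : (a * f ^ N * v) • l.prod • γ 0 = (a' * f ^ N * v) • l'.prod • γ 0 := by
      rw [← hba, ← hca, ← mul_smul, ← mul_smul, heq]
    have hmemΦ : ∀ {n : ℕ} {a a' q : G}, n ≤ N → a' = a * f ^ n * q →
        dist (γ 0) (q • γ 0) ≤ 6 * κ₁ + 2 * κ₂ + 4 * U + 13 * δ + 1 →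
        dist (f ^ L • γ 0) (q • f ^ L • γ 0) ≤ 6 * κ₁ + 2 * κ₂ + 4 * U + 13 * δ + 1 →
        (a * f ^ N * v)⁻¹ * (a' * f ^ N * v) ∈ Φ v := by
      rintro n a _ q hn rfl h1 h2
      exact ⟨(n, q), ⟨hn, by linarith, by linarith⟩, by simp only; group⟩
    rcases le_total (dist (γ 0) (a • γ 0)) (dist (γ 0) (a' • γ 0)) with hle | hle
    · obtain ⟨n, hn, q, haq, h1, h2⟩ := hmark.exists_eq_mul H hγ ha ha' hz hz' heq' hle hNL
      refine hsep b hb c hc ?_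
      rw [hba, hca]
      exact hmemΦ hn haq h1 h2
    · obtain ⟨n, hn, q, haq, h1, h2⟩ := hmark.exists_eq_mul H hγ ha' ha hz' hz heq'.symm hle hNL
      refine (hsep c hc b hb ?_).symm
      rw [hba, hca]
      exact hmemΦ hn haq h1 h2

end Branching

end HypBarrier

theorem mainTheorem6 {G X : Type*} [Group G] [MetricSpace X] [MulAction G X]
    [IsIsometricSMul G X] (δ : ℝ) (hδ : 0 < δ) (hX : HypBarrier.IsHyperbolic X δ)
    (hG : ¬ HypBarrier.IsVirtuallyCyclic G)
    (f : G) (γ : ℝ → X) (hγ : HypBarrier.IsUnitalAxis f γ)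
    (x₀ : X) (hx₀ : x₀ ∈ Set.range γ) (hf : HypBarrier.IsWPD f x₀)
    (S : Set G) (hSfin : S.Finite) (hSgen : Subgroup.closure S = ⊤) :
    ∃ r : ℝ, 0 < r ∧ ∀ (R : ℝ) (y : X), 0 < R →
      ∃ B : Fin ⌊R / r⌋₊ → Set G,
        HypBarrier.IsRoughlyBranching S r (⋃ i, B i) ∧
        Pairwise (fun i j => Disjoint (B i) (B j)) ∧
        ∀ i, HypBarrier.IsBarrier S {1} (B i)
          {g : G | g • x₀ ∈ HypBarrier.halfspace R x₀ y} := by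
  open HypBarrier in
  have H := hX.fourPoint hδ.le
  obtain ⟨t₀, rfl⟩ := hx₀
  have hγ' := hγ.comp_add_right t₀
  set γ' : ℝ → X := fun t => γ (t + t₀)
  have hbase : γ t₀ = γ' 0 := by simp [γ']
  rw [hbase] at hf ⊢
  obtain ⟨C, κ, hC, hκ, hbar⟩ := exists_mem_support_avoidsAxes H hγ' hf hSfin
  obtain ⟨r₀, hr₀⟩ := exists_isRoughlyBranching H hγ' hf hG S hκ
  set r := max r₀ (2 * C) with hr
  have hr2 : 2 * C ≤ r := le_max_right _ _
  have hrpos : 0 < r := by linarith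
  refine ⟨r, hrpos, fun R y hR => ?_⟩
  -- the `i`-th barrier lies over the point at distance `r * i + r / 2` on the way to `y`
  refine ⟨fun i => {g | |gromovProduct (γ' 0) (g • γ' 0) y - (r * (i : ℕ) + r / 2)| < C ∧
    ∃ p, dist (γ' 0) p + dist p y = dist (γ' 0) y ∧ AvoidsAxes G γ' κ p (g • γ' 0)},
    hr₀ r (le_max_left _ _) y _ ?_, ?_, ?_⟩
  · intro g hg
    obtain ⟨i, hi⟩ := Set.mem_iUnion.1 hg
    exact hi.2
  · intro i j hij
    rw [Set.disjoint_left]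
    rintro g ⟨h1, -⟩ ⟨h2, -⟩
    have key : ∀ {i j : ℕ}, i < j → |gromovProduct (γ' 0) (g • γ' 0) y - (r * i + r / 2)| < C →
        |gromovProduct (γ' 0) (g • γ' 0) y - (r * j + r / 2)| < C → False := by
      intro i j hij h1 h2
      have h3 : (i : ℝ) + 1 ≤ j := by exact_mod_cast hij
      have h4 := mul_le_mul_of_nonneg_left h3 hrpos.le
      linarith [(abs_lt.1 h1).2, (abs_lt.1 h2).1]
    rcases lt_or_gt_of_ne (Fin.val_ne_of_ne hij) with h | h
    · exact key h h1 h2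
    · exact key h h2 h1
  · rintro i a rfl c hc w
    have hc : R < gromovProduct (γ' 0) (c • γ' 0) y := hc
    have hi : r * (i : ℕ) + r ≤ R := by
      have h1 : ((i : ℕ) : ℝ) + 1 ≤ (⌊R / r⌋₊ : ℕ) := by exact_mod_cast i.2
      have h2 := h1.trans (Nat.floor_le (by positivity))
      rw [le_div_iff₀ hrpos] at h2
      linarith
    have hi0 : 0 ≤ r * (i : ℕ) := by positivity
    obtain ⟨p, hpt, hp⟩ := hX.1.exists_between (o := γ' 0) (y := y) (t := r * (i : ℕ) + r / 2)
      (by linarith) (by linarith [gromovProduct_le_dist (γ' 0) (c • γ' 0) y])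
    obtain ⟨b, hb, hb1, hb2⟩ := hbar y p hp 1 c w
      (by rw [one_smul, hpt]; simp only [gromovProduct, dist_self]; linarith)
      (by rw [hpt]; linarith)
    exact ⟨b, hb, by rwa [hpt] at hb1, p, hp, hb2⟩
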